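/- **Setting.** Let $f = T_1 \vee \cdots \vee T_s$ be a DNF formula over $n$ variables: each term $T_j$ is a conjunction of literals in which no variable occurs both negated and unnegated, and $f$ is regarded as the function $f:\{-1,1\}^n\to\{0,1\}$ that it computes, where an input value $-1$ means "true", an input value $1$ means "false", and the output $1$ means "true". The number $s$ of terms is the size of $f$. The DNF has read $k$ if every variable occurs in at most $k$ of the terms. For $S\subseteq[n]$ let $\hat f(S)=\mathbf E_{x\in\{-1,1\}^n}\big[f(x)\prod_{i\in S}x_i\big]$ with $x$ uniform. For real $M$, $f$ is $\varepsilon$-concentrated on $M$ coefficients if there is a family $\mathcal S$ of subsets of $[n]$ with $|\mathcal S|\le M$ and $\sum_{S\notin\mathcal S}\hat f(S)^2\le\varepsilon$. Logarithms are to base $2$. **Theorem.** (1) There is an absolute constant $C>0$ such that the following holds for all integers $n\ge0$, $w\ge1$, $k\ge0$. Let $f$ be a DNF over $n$ variables, each of whose terms has exactly $w$ variables, and suppose that $f$ has read $k$ with $$k\le\frac{w}{4\log(ew)} .$$ Then, for every $\varepsilon>0$, $f$ is $\varepsilon$-concentrated on $2^{C\,w\log(1/\varepsilon)}$ coefficients.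 (2) Consequently, Mansour's conjecture holds for such DNFs: for every $\varepsilon>0$ there is a constant $D=D(\varepsilon)$, depending only on $\varepsilon$, such that every DNF $f$ as in (1) (for any $n,w,k$) of size $s\ge2$ is $\varepsilon$-concentrated on $s^{D}$ coefficients. -/

import Mathlib

/-- The cube `{-1,1}^n`; as an input value, `-1` means "true" and `1` means "false". -/
abbrev Cube (n : ℕ) : Type := Fin n → ℤˣ

/-- The monomial `x^S = ∏_{i ∈ S} x_i`. -/
def monomialChar {n : ℕ} (S : Finset (Fin n)) (x : Cube n) : ℝ :=
  ∏ i ∈ S, (((x i : ℤˣ) : ℤ) : ℝ)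

/-- The Fourier coefficient `E_x [f(x) x^S]`, with `x` uniform on `{-1,1}^n`. -/
noncomputable def fourierCoef {n : ℕ} (f : Cube n → ℝ) (S : Finset (Fin n)) : ℝ :=
  (∑ x : Cube n, f x * monomialChar S x) / 2 ^ n

/-- `f` is `ε`-concentrated on the family `F` of sets of variables. -/
def ConcentratedOn {n : ℕ} (f : Cube n → ℝ) (ε : ℝ) (F : Finset (Finset (Fin n))) : Prop :=
  ∑ S ∈ Fᶜ, fourierCoef f S ^ 2 ≤ ε

/-- `f` is `ε`-concentrated on `M` coefficients (`M` real). -/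
def ConcentratedOnCoeffs {n : ℕ} (f : Cube n → ℝ) (ε M : ℝ) : Prop :=
  ∃ F : Finset (Finset (Fin n)), (F.card : ℝ) ≤ M ∧ ConcentratedOn f ε F

/-- A term: a conjunction of literals in which no variable occurs with both signs. -/
structure DNFTerm (n : ℕ) where
  /-- the variables that occur unnegated -/
  pos : Finset (Fin n)
  /-- the variables that occur negated -/
  neg : Finset (Fin n)
  disj : Disjoint pos neg

/-- The set of variables of a term. -/
def DNFTerm.vars {n : ℕ} (T : DNFTerm n) : Finset (Fin n) := T.pos ∪ T.neg

/-- The input `x` satisfies the term `T`. -/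
def DNFTerm.Sat {n : ℕ} (T : DNFTerm n) (x : Cube n) : Prop :=
  (∀ i ∈ T.pos, x i = -1) ∧ (∀ i ∈ T.neg, x i = 1)

/-- A DNF formula `T_1 ∨ ⋯ ∨ T_s` over `n` variables. -/
structure DNF (n : ℕ) where
  /-- the number `s` of terms -/
  size : ℕ
  /-- the terms -/
  term : Fin size → DNFTerm n

open Classical in
/-- The `{0,1}`-valued function that the formula computes. -/
noncomputable def DNF.toFun {n : ℕ} (f : DNF n) (x : Cube n) : ℝ :=
  if ∃ j, (f.term j).Sat x then 1 else 0

/-- Every term has exactly `w` variables. -/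
def DNF.ExactWidth {n : ℕ} (f : DNF n) (w : ℕ) : Prop :=
  ∀ j, (f.term j).vars.card = w

/-- Every variable occurs in at most `k` terms. -/
def DNF.HasRead {n : ℕ} (f : DNF n) (k : ℕ) : Prop :=
  ∀ i : Fin n, (Finset.univ.filter fun j => i ∈ (f.term j).vars).card ≤ k

/-! Write q = 2^(-w) and let l be about log(1/ε). Call a term a local minimum of x if x satisfies it
and satisfies no term of smaller index sharing a variable with it. The satisfied term of smallest
index is always one, so 1 - f indicates that there are no local minima. Local minima have pairwise
disjoint variables, and their number M behaves much like a Poisson variable. This suggests expanding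
1 - f by inclusion-exclusion over sets J of local minima and stopping at size d = O(l).

If P(f = 0) < e^(-l), then f is almost constantly 1 and the empty set suffices. Otherwise two upper
bounds for P(f = 0) can be read backwards. A maximal family of disjoint terms gives size · q ≤ w² l
(`cubeProb_satNone_le_exp_size`). A local-lemma argument gives P(f = 0) ≤ exp(-∑ P(j is a local
minimum) + small), hence E[M] ≤ 2l (`cubeProb_satNone_le_exp`). The Bonferroni error is at most
binom(M, d), and its second moment is controlled by exponential moments of M
(`cubeMean_choose_sq_le`): local minima far from all others are treated as independent, and the
clustered ones are charged to a dominating set with at most half of them.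

The event that all terms of J are local minima still contains the condition that no predecessor is
satisfied. This is expanded again, over sets U of predecessors, and truncated at m = 12dk. The read
condition enters twice. By double counting, m terms involve at least mw/k = 12dw variables, so any U
of size m is satisfied with probability at most 2^(-12dw). And (ew)^(4k) ≤ 2^w, so there are only
2^(O(wd)) choices of U, few enough for the error to be negligible.

What remains is a signed sum of 2^(O(wl)) conjunctions, each of Fourier ℓ¹ norm at most 1. Keeping
its large coefficients gives part (1) (`concentratedOnCoeffs_of_approx`). For part (2), either size
· q ≤ ε and f is negligible in mean square, or 2^w < size/ε is polynomial in the size. -/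

/-- The mean of `f` over the uniform cube. -/
noncomputable def cubeMean {n : ℕ} (f : Cube n → ℝ) : ℝ := (∑ x, f x) / 2 ^ n

theorem card_cube (n : ℕ) : Fintype.card (Cube n) = 2 ^ n := by
  simp [Cube]

/-! ### Averages over the cube -/

section Mean
variable {n : ℕ} {f g : Cube n → ℝ}

theorem cubeMean_mono (h : ∀ x, f x ≤ g x) : cubeMean f ≤ cubeMean g := by
  unfold cubeMean
  gcongr with x
  exact h x

theorem cubeMean_nonneg (h : ∀ x, 0 ≤ f x) : 0 ≤ cubeMean f :=
  div_nonneg (Finset.sum_nonneg fun x _ => h x) (by positivity)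

theorem cubeMean_add (f g : Cube n → ℝ) :
    cubeMean (fun x => f x + g x) = cubeMean f + cubeMean g := by
  simp [cubeMean, Finset.sum_add_distrib, add_div]

theorem cubeMean_sub (f g : Cube n → ℝ) :
    cubeMean (fun x => f x - g x) = cubeMean f - cubeMean g := by
  simp [cubeMean, Finset.sum_sub_distrib, sub_div]

theorem cubeMean_const_mul (c : ℝ) (f : Cube n → ℝ) :
    cubeMean (fun x => c * f x) = c * cubeMean f := by
  simp only [cubeMean, ← Finset.mul_sum, mul_div_assoc]

theorem cubeMean_sum {ι : Type*} (s : Finset ι) (f : ι → Cube n → ℝ) :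
    cubeMean (fun x => ∑ i ∈ s, f i x) = ∑ i ∈ s, cubeMean (f i) := by
  simp only [cubeMean]
  rw [Finset.sum_comm, Finset.sum_div]

theorem cubeMean_const (c : ℝ) : cubeMean (fun _ : Cube n => c) = c := by
  simp only [cubeMean, Finset.sum_const, Finset.card_univ, card_cube, nsmul_eq_mul]
  push_cast
  field_simp

end Mean

/-! ### Fourier coefficients, and concentration from approximation -/

section Fourier
variable {n : ℕ}

theorem fourierCoef_eq_cubeMean (f : Cube n → ℝ) (S : Finset (Fin n)) :
    fourierCoef f S = cubeMean fun x => f x * monomialChar S x := rfl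

theorem fourierCoef_sub (f g : Cube n → ℝ) (S : Finset (Fin n)) :
    fourierCoef (fun x => f x - g x) S = fourierCoef f S - fourierCoef g S := by
  simp only [fourierCoef_eq_cubeMean, ← cubeMean_sub, sub_mul]

theorem fourierCoef_const_mul (c : ℝ) (f : Cube n → ℝ) (S : Finset (Fin n)) :
    fourierCoef (fun x => c * f x) S = c * fourierCoef f S := by
  simp only [fourierCoef_eq_cubeMean, ← cubeMean_const_mul, mul_assoc]

theorem fourierCoef_sum {ι : Type*} (s : Finset ι) (f : ι → Cube n → ℝ) (S : Finset (Fin n)) :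
    fourierCoef (fun x => ∑ i ∈ s, f i x) S = ∑ i ∈ s, fourierCoef (f i) S := by
  simp only [fourierCoef_eq_cubeMean, ← cubeMean_sum, Finset.sum_mul]

theorem coe_units_mul_self (u : ℤˣ) : ((u : ℤ) : ℝ) * ((u : ℤ) : ℝ) = 1 := by
  rcases Int.units_eq_one_or u with rfl | rfl <;> norm_num

theorem abs_monomialChar (S : Finset (Fin n)) (x : Cube n) : |monomialChar S x| = 1 := by
  rw [monomialChar, Finset.abs_prod]
  refine Finset.prod_eq_one fun i _ => ?_
  rcases Int.units_eq_one_or (x i) with h | h <;> simp [h]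

/-- The sum over S factors as ∏ (1 + x_i y_i), and a coordinate where x and y differ contributes a
zero factor. -/
theorem sum_monomialChar_mul (x y : Cube n) :
    ∑ S : Finset (Fin n), monomialChar S x * monomialChar S y = if x = y then 2 ^ n else 0 := by
  simp only [monomialChar, ← Finset.prod_mul_distrib]
  rw [← Finset.powerset_univ, ← Finset.prod_one_add]
  split_ifs with h
  · subst h
    simp only [coe_units_mul_self]
    norm_num
  · obtain ⟨i, hi⟩ := Function.ne_iff.mp h
    refine Finset.prod_eq_zero (Finset.mem_univ i) ?_
    rcases Int.units_eq_one_or (x i) with h1 | h1 <;>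
      rcases Int.units_eq_one_or (y i) with h2 | h2 <;> simp_all

/-- Parseval's identity. -/
theorem sum_fourierCoef_sq (f : Cube n → ℝ) :
    ∑ S, fourierCoef f S ^ 2 = cubeMean fun x => f x ^ 2 := by
  have h : ∀ S, fourierCoef f S ^ 2 =
      (∑ x, ∑ y, f x * f y * (monomialChar S x * monomialChar S y)) / (2 ^ n * 2 ^ n) := by
    intro S
    rw [fourierCoef, sq, div_mul_div_comm, Finset.sum_mul_sum]
    congr 1
    exact Finset.sum_congr rfl fun x _ => Finset.sum_congr rfl fun y _ => by ring
  simp only [h]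
  rw [← Finset.sum_div, Finset.sum_comm]
  simp_rw [Finset.sum_comm (s := (Finset.univ : Finset (Finset (Fin n)))), ← Finset.mul_sum,
    sum_monomialChar_mul]
  simp only [mul_ite, mul_zero, Finset.sum_ite_eq, Finset.mem_univ, if_true, ← Finset.sum_mul]
  rw [cubeMean, mul_div_mul_right _ _ (by positivity)]
  simp only [sq]

theorem abs_fourierCoef_le (f : Cube n → ℝ) (S : Finset (Fin n)) :
    |fourierCoef f S| ≤ cubeMean fun x => |f x| := by
  rw [fourierCoef, cubeMean, abs_div, abs_of_pos (by positivity : (0 : ℝ) < 2 ^ n)]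
  gcongr
  refine (Finset.abs_sum_le_sum_abs _ _).trans (le_of_eq ?_)
  simp [abs_mul, abs_monomialChar]

/-- A function that ignores the variable `i` has no Fourier weight on the sets containing `i`. -/
theorem fourierCoef_eq_zero {f : Cube n → ℝ} {S : Finset (Fin n)} {i : Fin n} (hi : i ∈ S)
    (hf : ∀ x, f (Function.update x i (-x i)) = f x) : fourierCoef f S = 0 := by
  have hinv : Function.Involutive fun x : Cube n => Function.update x i (-x i) := by
    intro x
    simp
  have hm : ∀ x : Cube n, monomialChar S (Function.update x i (-x i)) = -monomialChar S x := by
    intro x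
    rw [monomialChar, monomialChar, ← Finset.mul_prod_erase _ _ hi, ← Finset.mul_prod_erase _ _ hi,
      Function.update_self]
    rw [Finset.prod_congr rfl (g := fun j => (((x j : ℤˣ) : ℤ) : ℝ))]
    · simp
    · intro j hj
      rw [Function.update_of_ne (Finset.ne_of_mem_erase hj)]
  have h : ∑ x, f x * monomialChar S x = -∑ x, f x * monomialChar S x := by
    conv_lhs => rw [← Equiv.sum_comp hinv.toPerm]
    simp [Function.Involutive.coe_toPerm, hf, hm]
  rw [fourierCoef, self_eq_neg.mp h, zero_div]

theorem concentratedOn_of_zero_off {f : Cube n → ℝ} {ε : ℝ} (hε : 0 ≤ ε)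
    {F : Finset (Finset (Fin n))} (h : ∀ S ∉ F, fourierCoef f S = 0) : ConcentratedOn f ε F := by
  unfold ConcentratedOn
  rw [Finset.sum_eq_zero]
  · exact hε
  · intro S hS
    simp [h S (Finset.mem_compl.mp hS)]

theorem concentratedOn_of_mean_sq_le {f : Cube n → ℝ} {ε : ℝ} (F : Finset (Finset (Fin n)))
    (h : cubeMean (fun x => f x ^ 2) ≤ ε) : ConcentratedOn f ε F := by
  refine le_trans ?_ h
  rw [← sum_fourierCoef_sq]
  exact Finset.sum_le_sum_of_subset_of_nonneg (Finset.subset_univ _) fun _ _ _ => sq_nonneg _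

theorem fourierCoef_const {S : Finset (Fin n)} (hS : S.Nonempty) (c : ℝ) :
    fourierCoef (fun _ : Cube n => c) S = 0 := by
  obtain ⟨i, hi⟩ := hS
  exact fourierCoef_eq_zero hi fun _ => rfl

/-- A mean-square approximation of `1 - f` with small Fourier `ℓ¹` norm gives concentration of
`f`. -/
theorem concentratedOnCoeffs_of_approx {f g : Cube n → ℝ} {δ Λ τ : ℝ} (hτ : 0 < τ)
    (hg : ∑ S, |fourierCoef g S| ≤ Λ) (hfg : cubeMean (fun x => (1 - f x - g x) ^ 2) ≤ δ) :
    ConcentratedOnCoeffs f (2 * δ + 2 * (τ * Λ)) (Λ / τ + 1) := by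
  classical
  set F := Finset.univ.filter fun S => τ ≤ |fourierCoef g S| with hF
  -- The empty set is added because the constant 1 has its only coefficient there; elsewhere the
  -- coefficients of `g` approximate those of `-f`.
  refine ⟨insert ∅ F, ?_, ?_⟩
  · have h1 : (F.card : ℝ) * τ ≤ Λ := by
      refine le_trans ?_ hg
      rw [← nsmul_eq_mul, ← Finset.sum_const]
      refine (Finset.sum_le_sum fun S hS => (Finset.mem_filter.mp hS).2).trans ?_
      exact Finset.sum_le_sum_of_subset_of_nonneg (Finset.subset_univ _) fun _ _ _ => abs_nonneg _
    have h2 : ((insert ∅ F).card : ℝ) ≤ F.card + 1 := by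
      exact_mod_cast Finset.card_insert_le _ _
    refine h2.trans ?_
    gcongr
    rwa [le_div_iff₀ hτ]
  · unfold ConcentratedOn
    have hS : ∀ S ∈ (insert ∅ F)ᶜ, fourierCoef f S ^ 2 ≤
        2 * fourierCoef (fun x => 1 - f x - g x) S ^ 2 + 2 * (τ * |fourierCoef g S|) := by
      intro S hS
      simp only [Finset.mem_compl, Finset.mem_insert, not_or, hF, Finset.mem_filter,
        Finset.mem_univ, true_and, not_le] at hS
      rw [fourierCoef_sub, fourierCoef_sub,
        fourierCoef_const (Finset.nonempty_iff_ne_empty.mpr hS.1), zero_sub]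
      -- Below the threshold τ, squares are at most τ times absolute values, so their sum is at most
      -- τΛ.
      have h3 : fourierCoef g S ^ 2 ≤ τ * |fourierCoef g S| := by
        rw [← sq_abs, sq]
        exact mul_le_mul_of_nonneg_right hS.2.le (abs_nonneg _)
      nlinarith [sq_nonneg (fourierCoef f S + 2 * fourierCoef g S)]
    refine (Finset.sum_le_sum hS).trans ?_
    rw [Finset.sum_add_distrib, ← Finset.mul_sum, ← Finset.mul_sum, ← Finset.mul_sum]
    have h4 : ∑ S ∈ (insert ∅ F)ᶜ, fourierCoef (fun x => 1 - f x - g x) S ^ 2 ≤ δ := by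
      refine le_trans ?_ hfg
      rw [← sum_fourierCoef_sq]
      exact Finset.sum_le_sum_of_subset_of_nonneg (Finset.subset_univ _) fun _ _ _ => sq_nonneg _
    have h5 : ∑ S ∈ (insert ∅ F)ᶜ, |fourierCoef g S| ≤ Λ :=
      (Finset.sum_le_sum_of_subset_of_nonneg (Finset.subset_univ _)
        fun _ _ _ => abs_nonneg _).trans hg
    gcongr

end Fourier

/-! ### Events on the cube and independence -/

section Prob
variable {n : ℕ} {p q : Cube n → Prop}

open Classical in
/-- The `{0,1}`-valued indicator of a predicate on the cube. -/
noncomputable def cubeInd (p : Cube n → Prop) (x : Cube n) : ℝ := if p x then 1 else 0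

/-- The probability of a predicate under the uniform distribution on the cube. -/
noncomputable def cubeProb (p : Cube n → Prop) : ℝ := cubeMean (cubeInd p)

theorem cubeInd_of_pos {x : Cube n} (h : p x) : cubeInd p x = 1 := if_pos h

theorem cubeInd_of_neg {x : Cube n} (h : ¬p x) : cubeInd p x = 0 := if_neg h

theorem cubeInd_congr {x y : Cube n} (h : p x ↔ q y) : cubeInd p x = cubeInd q y := by
  by_cases hp : p x
  · rw [cubeInd_of_pos hp, cubeInd_of_pos (h.1 hp)]
  · rw [cubeInd_of_neg hp, cubeInd_of_neg (fun hq => hp (h.2 hq))]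

theorem cubeInd_nonneg (p : Cube n → Prop) (x : Cube n) : 0 ≤ cubeInd p x := by
  unfold cubeInd; split_ifs <;> norm_num

theorem cubeInd_and (x : Cube n) : cubeInd (fun x => p x ∧ q x) x = cubeInd p x * cubeInd q x := by
  unfold cubeInd; split_ifs <;> simp_all

theorem cubeProb_nonneg (p : Cube n → Prop) : 0 ≤ cubeProb p :=
  cubeMean_nonneg (cubeInd_nonneg p)

theorem cubeProb_mono (h : ∀ x, p x → q x) : cubeProb p ≤ cubeProb q := by
  refine cubeMean_mono fun x => ?_
  by_cases hp : p x
  · rw [cubeInd_of_pos hp, cubeInd_of_pos (h x hp)]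
  · rw [cubeInd_of_neg hp]; exact cubeInd_nonneg q x

theorem cubeProb_congr (h : ∀ x, p x ↔ q x) : cubeProb p = cubeProb q :=
  le_antisymm (cubeProb_mono fun x => (h x).1) (cubeProb_mono fun x => (h x).2)

theorem cubeProb_true : cubeProb (fun _ : Cube n => True) = 1 := by
  have : cubeInd (fun _ : Cube n => True) = fun _ => 1 := by
    funext x; exact cubeInd_of_pos (p := fun _ => True) trivial
  rw [cubeProb, this, cubeMean_const]

theorem cubeProb_le_one (p : Cube n → Prop) : cubeProb p ≤ 1 := by
  rw [← cubeProb_true (n := n)]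
  exact cubeProb_mono fun _ _ => trivial

theorem cubeProb_and_not (p q : Cube n → Prop) :
    cubeProb (fun x => p x ∧ ¬q x) = cubeProb p - cubeProb (fun x => p x ∧ q x) := by
  rw [cubeProb, cubeProb, cubeProb, ← cubeMean_sub]
  congr 1
  funext x
  unfold cubeInd
  split_ifs <;> simp_all

theorem cubeProb_eq_zero (h : ∀ x, ¬p x) : cubeProb p = 0 := by
  have h0 : cubeInd p = fun _ => 0 := funext fun x => cubeInd_of_neg (h x)
  rw [cubeProb, h0, cubeMean_const]

/-- A union bound. -/
theorem cubeProb_le_add_sum {ι : Type*} (s : Finset ι) (r : ι → Cube n → Prop)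
    (h : ∀ x, p x → q x ∨ ∃ i ∈ s, r i x) :
    cubeProb p ≤ cubeProb q + ∑ i ∈ s, cubeProb (r i) := by
  simp only [cubeProb]
  rw [← cubeMean_sum, ← cubeMean_add]
  refine cubeMean_mono fun x => ?_
  have h0 : 0 ≤ ∑ i ∈ s, cubeInd (r i) x := Finset.sum_nonneg fun i _ => cubeInd_nonneg _ x
  have h1 := cubeInd_nonneg q x
  by_cases hp : p x
  · rw [cubeInd_of_pos hp]
    rcases h x hp with hq | ⟨i, hi, hr⟩
    · rw [cubeInd_of_pos hq]
      linarith
    · have := Finset.single_le_sum (f := fun i => cubeInd (r i) x)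
        (fun i _ => cubeInd_nonneg _ x) hi
      simp only [cubeInd_of_pos hr] at this
      linarith
  · rw [cubeInd_of_neg hp]
    linarith

theorem dependsOn_cubeInd {A : Set (Fin n)} (hp : DependsOn p A) : DependsOn (cubeInd p) A :=
  fun _ _ h => cubeInd_congr (iff_of_eq (hp h))

/-- Functions of disjoint sets of variables are uncorrelated. -/
theorem cubeMean_mul_of_disjoint {f g : Cube n → ℝ} {A B : Finset (Fin n)}
    (hf : DependsOn f (A : Set (Fin n))) (hg : DependsOn g (B : Set (Fin n)))
    (hAB : Disjoint A B) : cubeMean (fun x => f x * g x) = cubeMean f * cubeMean g := by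
  classical
  -- Take two independent inputs and exchange their coordinates outside A: this preserves the
  -- measure, fixes the value of f at the first input, and moves g from the first input to the
  -- second.
  let σ : Cube n × Cube n → Cube n × Cube n := fun z =>
    (fun i => if i ∈ A then z.1 i else z.2 i, fun i => if i ∈ A then z.2 i else z.1 i)
  have hσ : Function.Involutive σ := by
    rintro ⟨x, y⟩
    ext i <;> simp only [σ] <;> split_ifs <;> rfl
  have h1 : ∀ z : Cube n × Cube n, f (σ z).1 * g (σ z).1 = f z.1 * g z.2 := by
    rintro ⟨x, y⟩
    congr 1
    · exact hf fun i hi => by simp [σ, Finset.mem_coe.mp hi]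
    · exact hg fun i hi => by
        simp [σ, Finset.disjoint_right.mp hAB (Finset.mem_coe.mp hi)]
  have h2 : ∑ z : Cube n × Cube n, f z.1 * g z.1 = ∑ z : Cube n × Cube n, f z.1 * g z.2 := by
    rw [← Equiv.sum_comp hσ.toPerm]
    simp only [Function.Involutive.coe_toPerm, h1]
  rw [Fintype.sum_prod_type, Fintype.sum_prod_type] at h2
  simp only [Finset.sum_const, Finset.card_univ, card_cube, nsmul_eq_mul, ← Finset.mul_sum,
    ← Finset.sum_mul] at h2
  push_cast at h2
  unfold cubeMean
  rw [div_mul_div_comm, ← h2]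
  field_simp

theorem cubeProb_and_of_disjoint {A B : Finset (Fin n)}
    (hp : DependsOn p (A : Set (Fin n))) (hq : DependsOn q (B : Set (Fin n)))
    (hAB : Disjoint A B) : cubeProb (fun x => p x ∧ q x) = cubeProb p * cubeProb q := by
  rw [cubeProb, cubeProb, cubeProb,
    ← cubeMean_mul_of_disjoint (dependsOn_cubeInd hp) (dependsOn_cubeInd hq) hAB]
  congr 1
  funext x
  exact cubeInd_and x

theorem dependsOn_forall {ι : Type*} (J : Finset ι) {P : ι → Cube n → Prop}
    {W : ι → Finset (Fin n)} (hP : ∀ j ∈ J, DependsOn (P j) (W j : Set (Fin n))) :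
    DependsOn (fun x => ∀ j ∈ J, P j x) (J.biUnion W : Set (Fin n)) := by
  intro x y h
  have : ∀ j ∈ J, P j x = P j y := fun j hj => hP j hj fun i hi => h i <| by
    simp only [Finset.coe_biUnion, Set.mem_iUnion]
    exact ⟨j, hj, hi⟩
  exact propext (forall₂_congr fun j hj => by rw [this j hj])

theorem DependsOn.not {A : Set (Fin n)} (hp : DependsOn p A) : DependsOn (fun x => ¬p x) A :=
  fun _ _ h => congrArg Not (hp h)

theorem DependsOn.and {A B : Set (Fin n)} (hp : DependsOn p A) (hq : DependsOn q B) :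
    DependsOn (fun x => p x ∧ q x) (A ∪ B) := fun _ _ h =>
  congrArg₂ And (hp fun i hi => h i (Or.inl hi)) (hq fun i hi => h i (Or.inr hi))

/-- Events determined by pairwise disjoint sets of variables are independent. -/
theorem cubeProb_forall_of_disjoint {ι : Type*} (J : Finset ι) {P : ι → Cube n → Prop}
    {W : ι → Finset (Fin n)} (hP : ∀ j ∈ J, DependsOn (P j) (W j : Set (Fin n)))
    (hW : ∀ i ∈ J, ∀ j ∈ J, i ≠ j → Disjoint (W i) (W j)) :
    cubeProb (fun x => ∀ j ∈ J, P j x) = ∏ j ∈ J, cubeProb (P j) := by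
  classical
  induction J using Finset.induction_on with
  | empty => simp [cubeProb_true]
  | insert a J ha ih =>
    rw [Finset.prod_insert ha, ← ih (fun j hj => hP j (Finset.mem_insert_of_mem hj))
      (fun i hi j hj => hW i (Finset.mem_insert_of_mem hi) j (Finset.mem_insert_of_mem hj)),
      ← cubeProb_and_of_disjoint (hP a (Finset.mem_insert_self _ _))
        (dependsOn_forall J fun j hj => hP j (Finset.mem_insert_of_mem hj))]
    · exact cubeProb_congr fun x => by simp
    · rw [Finset.disjoint_biUnion_right]
      exact fun j hj => hW a (Finset.mem_insert_self _ _) j (Finset.mem_insert_of_mem hj)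
        fun h => ha (h ▸ hj)

theorem cubeProb_subcube (V : Finset (Fin n)) (a : Cube n) :
    cubeProb (fun x => ∀ i ∈ V, x i = a i) = (2⁻¹ : ℝ) ^ V.card := by
  classical
  have h1 : ∀ i ∈ V, DependsOn (fun x : Cube n => x i = a i) (({i} : Finset (Fin n)) : Set (Fin n)) := by
    intro i _ x y h
    simp [h i (by simp)]
  rw [cubeProb_forall_of_disjoint V h1 fun i _ j _ hij => by simpa using hij,
    Finset.prod_congr rfl (g := fun _ => (2⁻¹ : ℝ)), Finset.prod_const]
  intro i _
  have hinv : Function.Involutive fun x : Cube n => Function.update x i (-x i) := by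
    intro x
    simp
  have h2 : cubeProb (fun x : Cube n => x i = a i) =
      cubeProb (fun x : Cube n => True ∧ ¬ x i = a i) := by
    unfold cubeProb cubeMean
    rw [← Equiv.sum_comp hinv.toPerm]
    congr 1
    refine Finset.sum_congr rfl fun x _ => ?_
    simp only [cubeInd, Function.Involutive.coe_toPerm, Function.update_self, true_and]
    rcases Int.units_eq_one_or (x i) with h | h <;>
      rcases Int.units_eq_one_or (a i) with h' | h' <;> simp [h, h']
  rw [cubeProb_and_not, cubeProb_true] at h2
  simp only [true_and] at h2
  linarith

end Prob

/-! ### Conjunctions of terms as subcubes -/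

namespace DNF
variable {n : ℕ} (f : DNF n)

/-- All terms with index in `U` are satisfied. -/
def SatAll (U : Finset (Fin f.size)) (x : Cube n) : Prop := ∀ j ∈ U, (f.term j).Sat x

/-- No term with index in `U` is satisfied. -/
def SatNone (U : Finset (Fin f.size)) (x : Cube n) : Prop := ∀ j ∈ U, ¬(f.term j).Sat x

/-- The variables of the terms with index in `U`. -/
def varsOf (U : Finset (Fin f.size)) : Finset (Fin n) := U.biUnion fun j => (f.term j).vars

theorem _root_.DNFTerm.dependsOn_sat (T : DNFTerm n) : DependsOn T.Sat (T.vars : Set (Fin n)) := by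
  intro x y h
  unfold DNFTerm.Sat
  congr 1
  · exact propext (forall₂_congr fun i hi => by
      rw [h i (by simp [DNFTerm.vars, hi])])
  · exact propext (forall₂_congr fun i hi => by
      rw [h i (by simp [DNFTerm.vars, hi])])

theorem _root_.DNFTerm.Sat.iff {T : DNFTerm n} {a : Cube n} (ha : T.Sat a) (x : Cube n) :
    T.Sat x ↔ ∀ i ∈ T.vars, x i = a i := by
  constructor
  · intro hx i hi
    rcases Finset.mem_union.mp hi with hi | hi
    · rw [hx.1 i hi, ha.1 i hi]
    · rw [hx.2 i hi, ha.2 i hi]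
  · intro h
    rwa [T.dependsOn_sat (y := a) fun i hi => h i hi]

theorem _root_.DNFTerm.exists_sat (T : DNFTerm n) : ∃ a, T.Sat a := by
  classical
  refine ⟨fun i => if i ∈ T.pos then -1 else 1, fun i hi => if_pos hi, fun i hi => if_neg ?_⟩
  exact Finset.disjoint_right.mp T.disj hi

theorem dependsOn_satAll (U : Finset (Fin f.size)) :
    DependsOn (f.SatAll U) (f.varsOf U : Set (Fin n)) :=
  dependsOn_forall U fun j _ => (f.term j).dependsOn_sat

theorem dependsOn_satNone (U : Finset (Fin f.size)) :
    DependsOn (f.SatNone U) (f.varsOf U : Set (Fin n)) :=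
  dependsOn_forall U fun j _ => (f.term j).dependsOn_sat.not

theorem cubeProb_sat (j : Fin f.size) :
    cubeProb (f.term j).Sat = (2⁻¹ : ℝ) ^ (f.term j).vars.card := by
  obtain ⟨a, ha⟩ := (f.term j).exists_sat
  rw [cubeProb_congr ha.iff, cubeProb_subcube]

theorem satAll_iff {U : Finset (Fin f.size)} {a : Cube n} (ha : f.SatAll U a) (x : Cube n) :
    f.SatAll U x ↔ ∀ i ∈ f.varsOf U, x i = a i := by
  simp only [SatAll, varsOf, Finset.mem_biUnion]
  constructor
  · rintro h i ⟨j, hj, hi⟩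
    exact ((ha j hj).iff x).1 (h j hj) i hi
  · intro h j hj
    exact ((ha j hj).iff x).2 fun i hi => h i ⟨j, hj, hi⟩

/-- The common satisfying inputs form a subcube fixing all the variables involved, unless the terms
contradict each other; hence only an inequality. -/
theorem cubeProb_satAll_le (U : Finset (Fin f.size)) :
    cubeProb (f.SatAll U) ≤ (2⁻¹ : ℝ) ^ (f.varsOf U).card := by
  by_cases h : ∃ a, f.SatAll U a
  · obtain ⟨a, ha⟩ := h
    rw [cubeProb_congr (f.satAll_iff ha), cubeProb_subcube]
  · push Not at h
    rw [cubeProb_eq_zero h]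
    positivity

/-- The Fourier `ℓ¹` norm of a conjunction of terms is at most `1`. -/
theorem sum_abs_fourierCoef_satAll_le (U : Finset (Fin f.size)) :
    ∑ S, |fourierCoef (cubeInd (f.SatAll U)) S| ≤ 1 := by
  have h0 : ∀ S ∉ (f.varsOf U).powerset, |fourierCoef (cubeInd (f.SatAll U)) S| = 0 := by
    intro S hS
    rw [Finset.mem_powerset, Finset.not_subset] at hS
    obtain ⟨i, hiS, hi⟩ := hS
    rw [fourierCoef_eq_zero hiS, abs_zero]
    intro x
    refine dependsOn_cubeInd (f.dependsOn_satAll U) fun j hj => Function.update_of_ne ?_ _ _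
    rintro rfl
    exact hi (Finset.mem_coe.mp hj)
  rw [← Finset.sum_subset (Finset.subset_univ (f.varsOf U).powerset) fun S _ hS => h0 S hS]
  -- There are 2^|V| relevant sets S, V being the variables involved, and each coefficient is
  -- bounded by the probability 2^(-|V|).
  have h1 : ∀ S ∈ (f.varsOf U).powerset, |fourierCoef (cubeInd (f.SatAll U)) S| ≤
      (2⁻¹ : ℝ) ^ (f.varsOf U).card := by
    intro S _
    refine ((abs_fourierCoef_le _ _).trans (le_of_eq ?_)).trans (f.cubeProb_satAll_le U)
    rw [cubeProb]
    congr 1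
    funext x
    exact abs_of_nonneg (cubeInd_nonneg _ x)
  refine (Finset.sum_le_sum h1).trans (le_of_eq ?_)
  rw [Finset.sum_const, Finset.card_powerset, nsmul_eq_mul]
  push_cast
  rw [← mul_pow]
  norm_num

end DNF

/-! ### The dependency graph of the terms -/

namespace DNF
variable {n : ℕ} (f : DNF n)

open Classical in
/-- The terms that share a variable with the term `j`, together with `j` itself. -/
noncomputable def nbr (j : Fin f.size) : Finset (Fin f.size) :=
  Finset.univ.filter fun i => i = j ∨ ¬Disjoint (f.term i).vars (f.term j).vars

/-- The neighbours of `j` with smaller index. -/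
noncomputable def pred (j : Fin f.size) : Finset (Fin f.size) := (f.nbr j).filter (· < j)

/-- The variables of the neighbours of `j`. -/
noncomputable def hood (j : Fin f.size) : Finset (Fin n) := f.varsOf (f.nbr j)

open Classical in
/-- The terms whose neighbourhood shares a variable with that of `j`. -/
noncomputable def near (j : Fin f.size) : Finset (Fin f.size) :=
  Finset.univ.filter fun i => i = j ∨ ¬Disjoint (f.hood i) (f.hood j)

/-- The term `j` is satisfied and none of its neighbours of smaller index is. -/
def IsLocalMin (j : Fin f.size) (x : Cube n) : Prop := (f.term j).Sat x ∧ f.SatNone (f.pred j) x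

variable {f}

theorem mem_nbr {i j : Fin f.size} :
    i ∈ f.nbr j ↔ i = j ∨ ¬Disjoint (f.term i).vars (f.term j).vars := by
  simp [nbr]

theorem mem_near {i j : Fin f.size} :
    i ∈ f.near j ↔ i = j ∨ ¬Disjoint (f.hood i) (f.hood j) := by
  simp [near]

theorem mem_pred {i j : Fin f.size} : i ∈ f.pred j ↔ i ∈ f.nbr j ∧ i < j := by
  simp [pred]

theorem mem_nbr_self (j : Fin f.size) : j ∈ f.nbr j := mem_nbr.2 (Or.inl rfl)

theorem mem_nbr_comm {i j : Fin f.size} : i ∈ f.nbr j ↔ j ∈ f.nbr i := by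
  rw [mem_nbr, mem_nbr, eq_comm, disjoint_comm]

theorem mem_near_comm {i j : Fin f.size} : i ∈ f.near j ↔ j ∈ f.near i := by
  rw [mem_near, mem_near, eq_comm, disjoint_comm]

theorem disjoint_vars {i j : Fin f.size} (h : i ∉ f.nbr j) :
    Disjoint (f.term i).vars (f.term j).vars := by
  rw [mem_nbr, not_or, not_not] at h
  exact h.2

theorem disjoint_hood {i j : Fin f.size} (h : i ∉ f.near j) : Disjoint (f.hood i) (f.hood j) := by
  rw [mem_near, not_or, not_not] at h
  exact h.2

theorem vars_subset_varsOf {j : Fin f.size} {U : Finset (Fin f.size)} (h : j ∈ U) :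
    (f.term j).vars ⊆ f.varsOf U := Finset.subset_biUnion_of_mem (fun j => (f.term j).vars) h

theorem varsOf_mono {U U' : Finset (Fin f.size)} (h : U ⊆ U') : f.varsOf U ⊆ f.varsOf U' :=
  Finset.biUnion_subset_biUnion_of_subset_left _ h

theorem vars_subset_hood (j : Fin f.size) : (f.term j).vars ⊆ f.hood j :=
  vars_subset_varsOf (mem_nbr_self j)

theorem mem_near_of_mem_nbr {w : ℕ} (hw : 1 ≤ w) (hf : f.ExactWidth w) {i j : Fin f.size}
    (h : i ∈ f.nbr j) : i ∈ f.near j := by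
  rw [mem_near]
  refine Or.inr (Finset.not_disjoint_iff.2 ?_)
  have : (f.term i).vars.Nonempty := by
    rw [← Finset.card_pos, hf i]; exact hw
  obtain ⟨v, hv⟩ := this
  exact ⟨v, vars_subset_hood i hv, vars_subset_varsOf h hv⟩

/-- Together with `disjoint_hood`, this makes local-minimum events independent for terms that are
not near each other. -/
theorem dependsOn_isLocalMin (j : Fin f.size) :
    DependsOn (f.IsLocalMin j) (f.hood j : Set (Fin n)) := by
  have h1 : ∀ i ∈ (f.hood j : Set (Fin n))ᶜ, i ∉ ((f.term j).vars : Set (Fin n)) ∪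
      (f.varsOf (f.pred j) : Set (Fin n)) := by
    rintro i hi (h | h)
    · exact hi (vars_subset_hood j h)
    · exact hi (varsOf_mono (Finset.filter_subset _ _) h)
  intro x y h
  refine ((f.term j).dependsOn_sat.and (f.dependsOn_satNone (f.pred j))) fun i hi => h i ?_
  by_contra hc
  exact h1 i hc hi

theorem card_touching_le {k : ℕ} (hk : f.HasRead k) (V : Finset (Fin n)) :
    (Finset.univ.filter fun j => ¬Disjoint (f.term j).vars V).card ≤ V.card * k := by
  classical
  refine (Finset.card_le_card (t := V.biUnion fun v =>
    Finset.univ.filter fun j => v ∈ (f.term j).vars) ?_).trans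
      (Finset.card_biUnion_le_card_mul _ _ _ fun v _ => hk v)
  intro j hj
  simp only [Finset.mem_filter, Finset.mem_univ, true_and, Finset.not_disjoint_iff] at hj
  obtain ⟨v, hv, hv'⟩ := hj
  simp only [Finset.mem_biUnion, Finset.mem_filter, Finset.mem_univ, true_and]
  exact ⟨v, hv', hv⟩

theorem card_nbr_le {w k : ℕ} (hw : 1 ≤ w) (hf : f.ExactWidth w) (hk : f.HasRead k)
    (j : Fin f.size) : (f.nbr j).card ≤ w * k := by
  classical
  have h := card_touching_le hk (f.term j).vars
  rw [hf j] at h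
  refine (Finset.card_le_card fun i hi => ?_).trans h
  rw [Finset.mem_filter]
  refine ⟨Finset.mem_univ _, ?_⟩
  rcases mem_nbr.1 hi with rfl | h
  · rw [disjoint_self]
    intro h0
    have := hf i
    rw [h0] at this
    simp at this
    omega
  · exact h

theorem card_varsOf_le {w : ℕ} (hf : f.ExactWidth w) (U : Finset (Fin f.size)) :
    (f.varsOf U).card ≤ U.card * w :=
  Finset.card_biUnion_le_card_mul _ _ _ fun j _ => (hf j).le

theorem card_varsOf_of_disjoint {w : ℕ} (hf : f.ExactWidth w) {U : Finset (Fin f.size)}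
    (hU : ∀ i ∈ U, ∀ j ∈ U, i ≠ j → i ∉ f.nbr j) : (f.varsOf U).card = U.card * w := by
  rw [varsOf, Finset.card_biUnion fun i hi j hj hij => disjoint_vars (hU i hi j hj hij),
    Finset.sum_congr rfl fun j _ => hf j, Finset.sum_const, smul_eq_mul]

/-- In a read-`k` DNF the terms in `U` have at least `|U| w / k` variables. -/
theorem card_mul_le_varsOf {w k : ℕ} (hf : f.ExactWidth w) (hk : f.HasRead k)
    (U : Finset (Fin f.size)) : U.card * w ≤ (f.varsOf U).card * k := by
  classical
  have h : U.card * w = ∑ j ∈ U, ((f.varsOf U).filter fun v => v ∈ (f.term j).vars).card := by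
    rw [← smul_eq_mul, ← Finset.sum_const]
    refine Finset.sum_congr rfl fun j hj => ?_
    rw [← hf j]
    congr 1
    ext v
    simp only [Finset.mem_filter]
    exact ⟨fun h => ⟨vars_subset_varsOf hj h, h⟩, fun h => h.2⟩
  rw [h]
  have h2 := Finset.sum_card_bipartiteAbove_eq_sum_card_bipartiteBelow (s := U) (t := f.varsOf U)
    (fun j v => v ∈ (f.term j).vars)
  simp only [Finset.bipartiteAbove, Finset.bipartiteBelow] at h2
  rw [h2, ← smul_eq_mul]
  refine Finset.sum_le_card_nsmul _ _ _ fun v _ => ?_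
  exact (Finset.card_le_card (Finset.filter_subset_filter _ (Finset.subset_univ U))).trans (hk v)

/-- A near term is reached from `j` through a variable of its hood (at most w²k), a term containing
that variable (at most k), and a neighbour of that term (at most wk). -/
theorem card_near_le {w k : ℕ} (hw : 1 ≤ w) (hf : f.ExactWidth w) (hk : f.HasRead k)
    (j : Fin f.size) : (f.near j).card ≤ (w * k) ^ 3 := by
  classical
  have h1 : (f.hood j).card ≤ w * k * w :=
    (card_varsOf_le hf _).trans (Nat.mul_le_mul_right _ (card_nbr_le hw hf hk j))
  have hsub : f.near j ⊆ (f.hood j).biUnion fun v =>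
      (Finset.univ.filter fun a => v ∈ (f.term a).vars).biUnion f.nbr := by
    intro i hi
    have : ¬Disjoint (f.hood i) (f.hood j) := by
      rcases mem_near.1 hi with rfl | h
      · have : i ∈ f.near i := mem_near_of_mem_nbr hw hf (mem_nbr_self i)
        rw [disjoint_self]
        intro h0
        have h2 := vars_subset_hood i
        rw [h0, Finset.bot_eq_empty, Finset.subset_empty] at h2
        have := hf i
        rw [h2] at this
        simp at this
        omega
      · exact h
    obtain ⟨v, hv, hv'⟩ := Finset.not_disjoint_iff.1 this
    obtain ⟨a, ha, hva⟩ := Finset.mem_biUnion.1 hv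
    simp only [Finset.mem_biUnion, Finset.mem_filter, Finset.mem_univ, true_and]
    exact ⟨v, hv', a, hva, mem_nbr_comm.1 ha⟩
  refine (Finset.card_le_card hsub).trans ?_
  refine (Finset.card_biUnion_le_card_mul _ _ (k * (w * k)) fun v _ => ?_).trans ?_
  · refine (Finset.card_biUnion_le_card_mul _ _ (w * k) fun a _ => card_nbr_le hw hf hk a).trans ?_
    exact Nat.mul_le_mul_right _ (hk v)
  · calc (f.hood j).card * (k * (w * k)) ≤ w * k * w * (k * (w * k)) := Nat.mul_le_mul_right _ h1
      _ = (w * k) ^ 3 := by ring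

theorem satNone_mono {S T : Finset (Fin f.size)} (h : S ⊆ T) (x : Cube n) (hx : f.SatNone T x) :
    f.SatNone S x := fun j hj => hx j (h hj)

theorem cubeProb_satNone_anti {S T : Finset (Fin f.size)} (h : S ⊆ T) :
    cubeProb (f.SatNone T) ≤ cubeProb (f.SatNone S) := cubeProb_mono (satNone_mono h)

theorem cubeProb_satNone_insert (S : Finset (Fin f.size)) (j : Fin f.size) :
    cubeProb (f.SatNone (insert j S)) =
      cubeProb (f.SatNone S) - cubeProb (fun x => f.SatNone S x ∧ (f.term j).Sat x) := by
  rw [← cubeProb_and_not]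
  refine cubeProb_congr fun x => ?_
  simp only [SatNone, Finset.forall_mem_insert]
  exact and_comm

theorem satNone_sdiff_disjoint {S X : Finset (Fin f.size)} {V : Finset (Fin n)}
    (h : ∀ i ∈ S, i ∉ X → Disjoint V (f.term i).vars) : Disjoint V (f.varsOf (S \ X)) := by
  rw [varsOf, Finset.disjoint_biUnion_right]
  intro i hi
  rw [Finset.mem_sdiff] at hi
  exact h i hi.1 hi.2

/-! ### Local lemma and upper bounds for P(f = 0) -/

section LocalLemma
variable {w D : ℕ}

/-- The terms of `X` are added one at a time, each costing a factor `c`. The hypothesis is limited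
to sets smaller than `m` so that it can serve as the induction hypothesis of the local lemma. -/
theorem pow_mul_cubeProb_satNone_le {c : ℝ} (hc : 0 ≤ c) {m : ℕ}
    (H : ∀ T : Finset (Fin f.size), T.card < m → ∀ j,
      c * cubeProb (f.SatNone T) ≤ cubeProb (f.SatNone (insert j T)))
    (T X : Finset (Fin f.size)) (h : T.card + X.card ≤ m) :
    c ^ X.card * cubeProb (f.SatNone T) ≤ cubeProb (f.SatNone (T ∪ X)) := by
  induction X using Finset.induction_on with
  | empty => simp
  | insert a X ha ih =>
    rw [Finset.card_insert_of_notMem ha] at h ⊢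
    have h1 := ih (by omega)
    have h2 := H (T ∪ X) ((Finset.card_union_le _ _).trans_lt (by omega)) a
    rw [Finset.union_insert]
    refine le_trans ?_ h2
    rw [pow_succ', mul_assoc]
    exact mul_le_mul_of_nonneg_left h1 hc

theorem half_le_one_sub_pow {q : ℝ} (hq1 : q ≤ 1) {m : ℕ} (h : m * q ≤ 1 / 4) :
    1 / 2 ≤ (1 - 2 * q) ^ m := by
  have := one_add_mul_le_pow (a := -(2 * q)) (by linarith) m
  rw [sub_eq_add_neg]
  linarith

/-- The local lemma for DNFs of bounded read. -/
theorem mul_cubeProb_satNone_le (hf : f.ExactWidth w) (hD : ∀ j, (f.nbr j).card ≤ D)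
    (hq : (D : ℝ) * 2⁻¹ ^ w ≤ 1 / 4) (hw : 1 ≤ w) (S : Finset (Fin f.size)) (j : Fin f.size) :
    (1 - 2 * 2⁻¹ ^ w) * cubeProb (f.SatNone S) ≤ cubeProb (f.SatNone (insert j S)) := by
  induction hm : S.card using Nat.strong_induction_on generalizing S j with
  | _ m ih =>
    have hq1 : (2⁻¹ : ℝ) ^ w ≤ 1 / 2 := by
      calc (2⁻¹ : ℝ) ^ w ≤ 2⁻¹ ^ 1 := pow_le_pow_of_le_one (by norm_num) (by norm_num) hw
        _ = 1 / 2 := by norm_num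
    have hq0 : (0 : ℝ) ≤ 2⁻¹ ^ w := by positivity
    -- Deleting the neighbours of j from S makes term j independent of the rest and, by induction,
    -- at most doubles the probability; so satisfying j costs at most 2q.
    have h1 := pow_mul_cubeProb_satNone_le (c := 1 - 2 * 2⁻¹ ^ w) (by linarith)
      (fun T hT j => ih T.card hT T j rfl) (S \ f.nbr j) (S ∩ f.nbr j)
      (by rw [Finset.card_sdiff_add_card_inter, hm])
    rw [Finset.sdiff_union_inter] at h1
    have hle : ((S ∩ f.nbr j).card : ℝ) ≤ D := by
      exact_mod_cast (Finset.card_le_card Finset.inter_subset_right).trans (hD j)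
    have h2 := half_le_one_sub_pow (by linarith) (m := (S ∩ f.nbr j).card)
      ((mul_le_mul_of_nonneg_right hle hq0).trans hq)
    have h3 : cubeProb (f.SatNone (S \ f.nbr j)) ≤ 2 * cubeProb (f.SatNone S) := by
      nlinarith [cubeProb_nonneg (f.SatNone (S \ f.nbr j))]
    have h4 : cubeProb (fun x => f.SatNone S x ∧ (f.term j).Sat x) ≤
        2⁻¹ ^ w * cubeProb (f.SatNone (S \ f.nbr j)) := by
      rw [← hf j, ← f.cubeProb_sat, ← cubeProb_and_of_disjoint (f.term j).dependsOn_sat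
        (f.dependsOn_satNone _)]
      · exact cubeProb_mono fun x hx => ⟨hx.2, satNone_mono Finset.sdiff_subset x hx.1⟩
      · exact satNone_sdiff_disjoint fun i _ hi => (disjoint_vars hi).symm
    rw [cubeProb_satNone_insert]
    nlinarith [cubeProb_nonneg (f.SatNone S)]

theorem cubeProb_satNone_le_two_mul (hf : f.ExactWidth w) (hD : ∀ j, (f.nbr j).card ≤ D)
    (hq : (D : ℝ) * 2⁻¹ ^ w ≤ 1 / 4) (hw : 1 ≤ w) (T X : Finset (Fin f.size))
    (hX : (X.card : ℝ) * 2⁻¹ ^ w ≤ 1 / 4) :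
    cubeProb (f.SatNone T) ≤ 2 * cubeProb (f.SatNone (T ∪ X)) := by
  have hq1 : (2⁻¹ : ℝ) ^ w ≤ 1 / 2 := by
    calc (2⁻¹ : ℝ) ^ w ≤ 2⁻¹ ^ 1 := pow_le_pow_of_le_one (by norm_num) (by norm_num) hw
      _ = 1 / 2 := by norm_num
  have h1 := pow_mul_cubeProb_satNone_le (c := 1 - 2 * 2⁻¹ ^ w) (by linarith)
    (fun T _ j => mul_cubeProb_satNone_le hf hD hq hw T j) T X le_rfl
  have h2 := half_le_one_sub_pow (by linarith) hX
  nlinarith [cubeProb_nonneg (f.SatNone T)]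

variable {Δ : ℕ}

/-- Let S be the terms before j. That j is a local minimum is independent of the terms of S not near
j, so both events hold with probability at least P(j is a local minimum) · P(no term of S holds).
Then either j is satisfied and no term of S is, or j is satisfied along with some i near j but not a
neighbour. In the latter case i and j have disjoint variables, costing q², and deleting everything
near either one costs a factor 2. A union bound over at most Δ such i gives the correction 2Δq². -/
theorem cubeProb_satNone_insert_Iio_le (hf : f.ExactWidth w) (hw : 1 ≤ w)
    (hΔ : ∀ j, (f.near j).card ≤ Δ) (hq : (Δ : ℝ) * 2⁻¹ ^ w ≤ 1 / 8) (j : Fin f.size) :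
    cubeProb (f.SatNone (insert j (Finset.Iio j))) ≤ cubeProb (f.SatNone (Finset.Iio j)) *
      (1 - cubeProb (f.IsLocalMin j) + 2 * Δ * (2⁻¹ ^ w) ^ 2) := by
  classical
  set q : ℝ := 2⁻¹ ^ w with hqdef
  have hq0 : 0 ≤ q := by positivity
  have hnn : ∀ j, f.nbr j ⊆ f.near j := fun j i hi => mem_near_of_mem_nbr hw hf hi
  have hD : ∀ j, (f.nbr j).card ≤ Δ := fun j => (Finset.card_le_card (hnn j)).trans (hΔ j)
  set S := Finset.Iio j with hS
  set R := (S ∩ f.near j) \ f.nbr j with hR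
  have hunion : cubeProb (fun x => f.IsLocalMin j x ∧ f.SatNone (S \ f.near j) x) ≤
      cubeProb (fun x => f.SatNone S x ∧ (f.term j).Sat x) + ∑ i ∈ R, cubeProb
        (fun x => f.SatAll {j, i} x ∧ f.SatNone (S \ (f.near j ∪ f.near i)) x) := by
    refine cubeProb_le_add_sum _ _ fun x hx => ?_
    by_cases h : ∃ i ∈ R, (f.term i).Sat x
    · obtain ⟨i, hi, hs⟩ := h
      refine Or.inr ⟨i, hi, ?_, satNone_mono ?_ x hx.2⟩
      · intro a ha
        simp only [Finset.mem_insert, Finset.mem_singleton] at ha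
        rcases ha with rfl | rfl
        · exact hx.1.1
        · exact hs
      · exact Finset.sdiff_subset_sdiff le_rfl Finset.subset_union_left
    · push Not at h
      refine Or.inl ⟨fun i hi => ?_, hx.1.1⟩
      by_cases h1 : i ∈ f.near j
      · by_cases h2 : i ∈ f.nbr j
        · exact hx.1.2 i (mem_pred.2 ⟨h2, Finset.mem_Iio.1 hi⟩)
        · exact h i (by simp [hR, hi, h1, h2])
      · exact hx.2 i (by simp [hi, h1])
  rw [cubeProb_and_of_disjoint (dependsOn_isLocalMin j) (f.dependsOn_satNone _)
    (satNone_sdiff_disjoint fun i _ hi =>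
      (disjoint_hood hi).symm.mono_right (vars_subset_hood i))] at hunion
  have hterm : ∀ i ∈ R, cubeProb
      (fun x => f.SatAll {j, i} x ∧ f.SatNone (S \ (f.near j ∪ f.near i)) x) ≤
      q ^ 2 * (2 * cubeProb (f.SatNone S)) := by
    intro i hi
    simp only [hR, Finset.mem_sdiff, Finset.mem_inter] at hi
    have hij : i ≠ j := fun h => hi.2 (h ▸ mem_nbr_self i)
    rw [cubeProb_and_of_disjoint (f.dependsOn_satAll _) (f.dependsOn_satNone _)]
    · have h1 := f.cubeProb_satAll_le {j, i}
      rw [card_varsOf_of_disjoint hf, Finset.card_pair hij.symm, mul_comm, pow_mul] at h1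
      -- Up to 2Δ terms are deleted here, which is why Δq ≤ 1/8 is assumed rather than 1/4.
      · have h2 := cubeProb_satNone_le_two_mul hf hD (hq.trans (by norm_num)) hw
          (S \ (f.near j ∪ f.near i)) (S ∩ (f.near j ∪ f.near i)) (by
            have : ((S ∩ (f.near j ∪ f.near i)).card : ℝ) ≤ Δ + Δ := by
              exact_mod_cast (Finset.card_le_card Finset.inter_subset_right).trans
                ((Finset.card_union_le _ _).trans (add_le_add (hΔ j) (hΔ i)))
            nlinarith)
        rw [Finset.sdiff_union_inter] at h2
        exact mul_le_mul h1 h2 (cubeProb_nonneg _) (by positivity)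
      · intro a ha b hb hab
        simp only [Finset.mem_insert, Finset.mem_singleton] at ha hb
        rcases ha with rfl | rfl <;> rcases hb with rfl | rfl
        · exact absurd rfl hab
        · exact fun h => hi.2 (mem_nbr_comm.1 h)
        · exact hi.2
        · exact absurd rfl hab
    · refine satNone_sdiff_disjoint fun b _ hb => ?_
      rw [Finset.mem_union, not_or] at hb
      rw [varsOf, Finset.disjoint_biUnion_left]
      intro a ha
      simp only [Finset.mem_insert, Finset.mem_singleton] at ha
      rcases ha with rfl | rfl
      · exact (disjoint_vars fun h => hb.1 (hnn _ h)).symm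
      · exact (disjoint_vars fun h => hb.2 (hnn _ h)).symm
  have hsum := Finset.sum_le_card_nsmul _ _ _ hterm
  rw [nsmul_eq_mul] at hsum
  have hRc : (R.card : ℝ) ≤ Δ := by
    exact_mod_cast (Finset.card_le_card
      (Finset.sdiff_subset.trans Finset.inter_subset_right)).trans (hΔ j)
  have hsum2 := hsum.trans (mul_le_mul_of_nonneg_right hRc (by
    have := cubeProb_nonneg (f.SatNone S); positivity))
  have hanti := cubeProb_satNone_anti (f := f) (S := S \ f.near j) (T := S) Finset.sdiff_subset
  have hmul := mul_le_mul_of_nonneg_left hanti (cubeProb_nonneg (f.IsLocalMin j))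
  rw [cubeProb_satNone_insert]
  nlinarith

/-- A Poisson-type bound for the probability that no term is satisfied. -/
theorem cubeProb_satNone_le_exp (hf : f.ExactWidth w) (hw : 1 ≤ w)
    (hΔ : ∀ j, (f.near j).card ≤ Δ) (hq : (Δ : ℝ) * 2⁻¹ ^ w ≤ 1 / 8) :
    cubeProb (f.SatNone Finset.univ) ≤
      Real.exp (∑ j, (-cubeProb (f.IsLocalMin j) + 2 * Δ * (2⁻¹ ^ w) ^ 2)) := by
  have key : ∀ m, m ≤ f.size →
      cubeProb (f.SatNone (Finset.univ.filter fun j => j.val < m)) ≤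
      Real.exp (∑ j ∈ Finset.univ.filter (fun j : Fin f.size => j.val < m),
        (-cubeProb (f.IsLocalMin j) + 2 * Δ * (2⁻¹ ^ w) ^ 2)) := by
    intro m
    induction m with
    | zero => intro _; simpa using cubeProb_le_one _
    | succ m ih =>
      intro hm
      have h1 : (Finset.univ.filter fun j : Fin f.size => j.val < m) = Finset.Iio ⟨m, hm⟩ := by
        ext j; simp [Fin.lt_def]
      have h2 : (Finset.univ.filter fun j : Fin f.size => j.val < m + 1) =
          insert ⟨m, hm⟩ (Finset.Iio ⟨m, hm⟩) := by
        ext j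
        simp only [Finset.mem_filter, Finset.mem_univ, true_and, Finset.mem_insert,
          Finset.mem_Iio, Fin.lt_def, Fin.ext_iff]
        omega
      have ih' := ih (by omega)
      rw [h1] at ih'
      rw [h2, Finset.sum_insert (by simp), Real.exp_add, mul_comm (Real.exp _)]
      refine (cubeProb_satNone_insert_Iio_le hf hw hΔ hq _).trans ?_
      refine (mul_le_mul_of_nonneg_left (Real.add_one_le_exp _ |>.trans' ?_)
        (cubeProb_nonneg _)).trans (mul_le_mul_of_nonneg_right ih' (Real.exp_pos _).le)
      linarith
  have := key f.size le_rfl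
  simpa using this

/-- A pairwise disjoint family of terms that every term meets. -/
theorem exists_disjoint_family (f : DNF n) : ∃ B : Finset (Fin f.size),
    (∀ i ∈ B, ∀ j ∈ B, i ≠ j → i ∉ f.nbr j) ∧ B.biUnion f.nbr = Finset.univ := by
  classical
  obtain ⟨B, hB, hmax⟩ := Finset.exists_max_image
    (Finset.univ.filter fun B : Finset (Fin f.size) => ∀ i ∈ B, ∀ j ∈ B, i ≠ j → i ∉ f.nbr j)
    Finset.card ⟨∅, by simp⟩
  rw [Finset.mem_filter] at hB
  refine ⟨B, hB.2, Finset.eq_univ_iff_forall.2 fun a => ?_⟩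
  by_contra ha
  simp only [Finset.mem_biUnion, not_exists, not_and] at ha
  have haB : a ∉ B := fun h => ha a h (mem_nbr_self a)
  have := hmax (insert a B) (by
    rw [Finset.mem_filter]
    refine ⟨Finset.mem_univ _, fun i hi j hj hij => ?_⟩
    rcases Finset.mem_insert.1 hi with rfl | hi' <;> rcases Finset.mem_insert.1 hj with rfl | hj'
    · exact absurd rfl hij
    · exact ha j hj'
    · exact fun h => ha i hi' (mem_nbr_comm.1 h)
    · exact hB.2 i hi' j hj' hij)
  rw [Finset.card_insert_of_notMem haB] at this
  omega

/-- Here b is the size of a maximal family of disjoint terms: its neighbourhoods cover all terms,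
and its members fail independently with probability 1 - q each. Cruder than the Poisson bound, this
serves to bound the size of the formula. -/
theorem cubeProb_satNone_le_exp_size (hf : f.ExactWidth w) (hD : ∀ j, (f.nbr j).card ≤ D) :
    ∃ b : ℕ, f.size ≤ b * D ∧
      cubeProb (f.SatNone Finset.univ) ≤ Real.exp (-(b * 2⁻¹ ^ w)) := by
  obtain ⟨B, hB, hcov⟩ := exists_disjoint_family f
  refine ⟨B.card, ?_, ?_⟩
  · have := Finset.card_biUnion_le_card_mul B f.nbr D fun j _ => hD j
    rwa [hcov, Finset.card_univ, Fintype.card_fin] at this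
  · refine (cubeProb_satNone_anti (Finset.subset_univ B)).trans ?_
    have h := cubeProb_forall_of_disjoint B (P := fun j x => ¬(f.term j).Sat x)
      (fun j _ => (f.term j).dependsOn_sat.not)
      fun i hi j hj hij => disjoint_vars (hB i hi j hj hij)
    have h2 : ∀ j, cubeProb (fun x => ¬(f.term j).Sat x) = 1 - 2⁻¹ ^ w := by
      intro j
      have := cubeProb_and_not (fun _ => True) (f.term j).Sat
      simpa [cubeProb_true, f.cubeProb_sat, hf j] using this
    rw [show f.SatNone B = fun x => ∀ j ∈ B, ¬(f.term j).Sat x from rfl, h,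
      Finset.prod_congr rfl fun j _ => h2 j, Finset.prod_const, ← mul_neg, Real.exp_nat_mul]
    have h3 : (2⁻¹ : ℝ) ^ w ≤ 1 := pow_le_one₀ (by norm_num) (by norm_num)
    refine pow_le_pow_left₀ (by linarith) ?_ _
    linarith [Real.add_one_le_exp (-(2⁻¹ : ℝ) ^ w)]

end LocalLemma

end DNF

/-! ### Dominating sets and Bonferroni's inequalities -/

section Combinatorics

theorem sum_powerset_pow {α : Type*} (c : ℝ) (s : Finset α) :
    ∑ t ∈ s.powerset, c ^ t.card = (1 + c) ^ s.card := by
  have := Finset.sum_pow_mul_eq_add_pow c 1 s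
  simpa [add_comm] using this

/-- A relation without isolated points has a dominating set with at most half of the points. -/
theorem exists_dominating_subset {α : Type*} [DecidableEq α] (A : Finset α) {R : α → α → Prop}
    (hsymm : ∀ a b, R a b → R b a) (hA : ∀ a ∈ A, ∃ b ∈ A, b ≠ a ∧ R b a) :
    ∃ C ⊆ A, (∀ a ∈ A \ C, ∃ c ∈ C, R c a) ∧ 2 * C.card ≤ A.card := by
  classical
  obtain ⟨C, hC, hmin⟩ := Finset.exists_min_image
    (A.powerset.filter fun C => ∀ a ∈ A \ C, ∃ c ∈ C, R c a) Finset.card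
    ⟨A, Finset.mem_filter.2 ⟨Finset.mem_powerset_self A, by simp⟩⟩
  rw [Finset.mem_filter, Finset.mem_powerset] at hC
  refine ⟨C, hC.1, hC.2, ?_⟩
  -- If a had no relative outside the minimum dominating set C, then C without a would still
  -- dominate. So the complement dominates too, and minimality gives |C| ≤ |A \ C|.
  have hcompl : ∀ a ∈ C, ∃ c ∈ A \ C, R c a := by
    intro a ha
    by_contra! hcon
    obtain ⟨b, hbA, hba, hR⟩ := hA a (hC.1 ha)
    have hbC : b ∈ C := by
      by_contra hb
      exact hcon b (Finset.mem_sdiff.2 ⟨hbA, hb⟩) hR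
    have := hmin (C.erase a) (by
      rw [Finset.mem_filter, Finset.mem_powerset]
      refine ⟨(Finset.erase_subset _ _).trans hC.1, fun x hx => ?_⟩
      rw [Finset.mem_sdiff, Finset.mem_erase, not_and_or, not_not] at hx
      by_cases hxa : x = a
      · exact ⟨b, Finset.mem_erase.2 ⟨hba, hbC⟩, hxa ▸ hR⟩
      · have hxC := hx.2.resolve_left hxa
        obtain ⟨c, hc, hcx⟩ := hC.2 x (Finset.mem_sdiff.2 ⟨hx.1, hxC⟩)
        refine ⟨c, Finset.mem_erase.2 ⟨?_, hc⟩, hcx⟩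
        rintro rfl
        exact hcon x (Finset.mem_sdiff.2 ⟨hx.1, hxC⟩) (hsymm _ _ hcx))
    rw [Finset.card_erase_of_mem ha] at this
    have := Finset.card_pos.2 ⟨a, ha⟩
    omega
  have h2 := hmin (A \ C) (by
    rw [Finset.mem_filter, Finset.mem_powerset]
    refine ⟨Finset.sdiff_subset, fun a ha => hcompl a ?_⟩
    rw [Finset.mem_sdiff, Finset.mem_sdiff] at ha
    by_contra h
    exact ha.2 ⟨ha.1, h⟩)
  rw [Finset.card_sdiff_of_subset hC.1] at h2
  have := Finset.card_le_card hC.1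
  omega

theorem sum_powerset_filter_card_le {α M : Type*} [AddCommMonoid M] (X : Finset α) (m : ℕ)
    (h : ℕ → M) :
    ∑ U ∈ X.powerset.filter (fun U => U.card ≤ m), h U.card =
      ∑ t ∈ Finset.range (m + 1), X.card.choose t • h t := by
  rw [← Finset.sum_fiberwise_of_maps_to (t := Finset.range (m + 1)) (g := Finset.card)
    fun U hU => Finset.mem_range_succ_iff.2 (Finset.mem_filter.1 hU).2]
  refine Finset.sum_congr rfl fun t ht => ?_
  rw [Finset.sum_congr rfl (g := fun _ => h t) fun U hU => by rw [(Finset.mem_filter.1 hU).2],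
    Finset.sum_const, ← Finset.card_powersetCard]
  congr 2
  ext U
  simp only [Finset.mem_filter, Finset.mem_powerset, Finset.mem_powersetCard]
  have := Finset.mem_range_succ_iff.1 ht
  constructor
  · exact fun h => ⟨h.1.1, h.2⟩
  · exact fun h => ⟨⟨h.1, h.2.trans_le this⟩, h.2⟩

/-- Bonferroni's inequalities. -/
theorem abs_bonferroni_le {α : Type*} [DecidableEq α] (X : Finset α) (m : ℕ) :
    |(if X = ∅ then (1 : ℝ) else 0) -
      ∑ U ∈ X.powerset.filter (fun U => U.card ≤ m), (-1) ^ U.card| ≤ X.card.choose m := by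
  rw [sum_powerset_filter_card_le X m fun t => (-1 : ℝ) ^ t]
  by_cases h : X = ∅
  · subst h
    rw [Finset.sum_range_succ']
    simp
  · obtain ⟨N, hN⟩ := Nat.exists_eq_succ_of_ne_zero (Finset.card_ne_zero_of_mem
      (Finset.nonempty_iff_ne_empty.2 h).choose_spec)
    have h2 := Int.alternating_sum_range_choose_eq_choose (n := N) (m := m)
    have h3 : ∑ t ∈ Finset.range (m + 1), (N + 1).choose t • (-1 : ℝ) ^ t =
        (-1) ^ m * N.choose m := by
      have := congrArg (Int.cast : ℤ → ℝ) h2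
      push_cast at this
      rw [← this]
      exact Finset.sum_congr rfl fun t _ => by rw [nsmul_eq_mul, mul_comm]
    rw [if_neg h, hN, Nat.succ_eq_add_one, h3, zero_sub, abs_neg, abs_mul, abs_pow, abs_neg,
      abs_one, one_pow, one_mul, Nat.abs_cast]
    exact_mod_cast Nat.choose_le_succ N m

end Combinatorics

/-! ### Local minima and their exponential moments -/

namespace DNF
variable {n : ℕ} {f : DNF n}

variable (f) in
open Classical in
/-- The satisfied terms none of whose neighbours of smaller index is satisfied. -/
noncomputable def localMins (x : Cube n) : Finset (Fin f.size) :=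
  Finset.univ.filter fun j => f.IsLocalMin j x

variable (f) in
open Classical in
/-- The local minima that have no other local minimum near them. -/
noncomputable def isolatedMins (x : Cube n) : Finset (Fin f.size) :=
  (f.localMins x).filter fun j => ∀ i ∈ f.localMins x, i ∈ f.near j → i = j

theorem mem_localMins {x : Cube n} {j : Fin f.size} : j ∈ f.localMins x ↔ f.IsLocalMin j x := by
  simp [localMins]

/-- Of two satisfied neighbours, the one with the larger index is not a local minimum. -/
theorem notMem_nbr_of_localMins {x : Cube n} {i j : Fin f.size} (hi : i ∈ f.localMins x)
    (hj : j ∈ f.localMins x) (hij : i ≠ j) : i ∉ f.nbr j := by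
  rw [mem_localMins] at hi hj
  intro h
  rcases lt_or_gt_of_ne hij with hlt | hlt
  · exact hj.2 i (mem_pred.2 ⟨h, hlt⟩) hi.1
  · exact hi.2 j (mem_pred.2 ⟨mem_nbr_comm.1 h, hlt⟩) hj.1

theorem localMins_eq_empty_iff {x : Cube n} : f.localMins x = ∅ ↔ f.SatNone Finset.univ x := by
  classical
  constructor
  · intro h j _ hj
    obtain ⟨i, hi, hmin⟩ := Finset.exists_min_image
      (Finset.univ.filter fun i => (f.term i).Sat x) id ⟨j, by simpa using hj⟩
    have : i ∈ f.localMins x := by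
      refine mem_localMins.2 ⟨(Finset.mem_filter.1 hi).2, fun a ha ha2 => ?_⟩
      exact absurd (hmin a (by simpa using ha2)) (not_le.2 (mem_pred.1 ha).2)
    simp [h] at this
  · intro h
    refine Finset.eq_empty_of_forall_notMem fun j hj => ?_
    exact h j (Finset.mem_univ _) (mem_localMins.1 hj).1

section Moments

/-- If two members of `J` are near each other, they cannot both be isolated; otherwise their hoods
are disjoint and the events are independent. -/
theorem cubeProb_subset_isolatedMins_le (J : Finset (Fin f.size)) :
    cubeProb (fun x => J ⊆ f.isolatedMins x) ≤ ∏ j ∈ J, cubeProb (f.IsLocalMin j) := by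
  classical
  by_cases hJ : ∀ i ∈ J, ∀ j ∈ J, i ≠ j → i ∉ f.near j
  · rw [← cubeProb_forall_of_disjoint J (fun j _ => dependsOn_isLocalMin j)
      fun i hi j hj hij => disjoint_hood (hJ i hi j hj hij)]
    exact cubeProb_mono fun x hx j hj => mem_localMins.1 (Finset.mem_filter.1 (hx hj)).1
  · push Not at hJ
    obtain ⟨i, hi, j, hj, hij, hn⟩ := hJ
    refine le_trans ?_ (Finset.prod_nonneg fun j _ => cubeProb_nonneg _)
    refine (cubeProb_eq_zero fun x hx => ?_).le
    have hi' := hx hi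
    have hj' := hx hj
    rw [isolatedMins, Finset.mem_filter] at hi' hj'
    exact hij (hj'.2 i hi'.1 hn)

/-- Expanding (1 + c)^|I| as a sum of c^|J| over J ⊆ I reduces the moment to product bounds, as for
a Poisson variable. -/
theorem cubeMean_pow_card_isolatedMins_le {c : ℝ} (hc : 0 ≤ c) :
    cubeMean (fun x => (1 + c) ^ (f.isolatedMins x).card) ≤
      Real.exp (c * ∑ j, cubeProb (f.IsLocalMin j)) := by
  classical
  have h1 : ∀ x, (1 + c) ^ (f.isolatedMins x).card =
      ∑ J : Finset (Fin f.size), c ^ J.card * cubeInd (fun x => J ⊆ f.isolatedMins x) x := by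
    intro x
    rw [← sum_powerset_pow, ← Finset.sum_subset (Finset.subset_univ (f.isolatedMins x).powerset)]
    · refine Finset.sum_congr rfl fun J hJ => ?_
      rw [cubeInd_of_pos (Finset.mem_powerset.1 hJ), mul_one]
    · intro J _ hJ
      rw [cubeInd_of_neg (fun h => hJ (Finset.mem_powerset.2 h)), mul_zero]
  simp only [h1]
  rw [cubeMean_sum]
  calc ∑ J : Finset (Fin f.size),
        cubeMean (fun x => c ^ J.card * cubeInd (fun x => J ⊆ f.isolatedMins x) x)
      ≤ ∑ J : Finset (Fin f.size), ∏ j ∈ J, (c * cubeProb (f.IsLocalMin j)) := by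
        refine Finset.sum_le_sum fun J _ => ?_
        rw [cubeMean_const_mul, Finset.prod_mul_distrib, Finset.prod_const]
        exact mul_le_mul_of_nonneg_left (cubeProb_subset_isolatedMins_le J) (by positivity)
    _ = ∏ j, (1 + c * cubeProb (f.IsLocalMin j)) := by
        rw [Finset.prod_one_add, Finset.powerset_univ]
    _ ≤ ∏ j, Real.exp (c * cubeProb (f.IsLocalMin j)) := by
        refine Finset.prod_le_prod (fun j _ => ?_) fun j _ => ?_
        · have := mul_nonneg hc (cubeProb_nonneg (f.IsLocalMin j))
          linarith
        · linarith [Real.add_one_le_exp (c * cubeProb (f.IsLocalMin j))]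
    _ = _ := by rw [← Real.exp_sum, Finset.mul_sum]

variable {w Δ : ℕ}

/-- The conditions on `C` and `D` are put inside the event so that one bound holds for every pair
and the sums below need not be restricted. -/
theorem cubeProb_satAll_union_le [DecidableEq (Fin f.size)] (hf : f.ExactWidth w)
    (C D : Finset (Fin f.size)) :
    cubeProb (fun x => (Disjoint C D ∧ ∀ i ∈ C ∪ D, ∀ j ∈ C ∪ D, i ≠ j → i ∉ f.nbr j) ∧
      f.SatAll (C ∪ D) x) ≤ (2⁻¹ ^ w) ^ C.card * (2⁻¹ ^ w) ^ D.card := by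
  by_cases h : Disjoint C D ∧ ∀ i ∈ C ∪ D, ∀ j ∈ C ∪ D, i ≠ j → i ∉ f.nbr j
  · rw [← pow_add, ← Finset.card_union_of_disjoint h.1, ← pow_mul, mul_comm,
      ← card_varsOf_of_disjoint hf h.2]
    exact (cubeProb_mono fun x hx => hx.2).trans (f.cubeProb_satAll_le _)
  · rw [cubeProb_eq_zero fun x hx => h hx.1]
    positivity

/-- Every non-isolated local minimum has another one near it, so the set B of them has a dominating
subset C with |C| ≤ |B \ C|. The summand of the pair (C, B \ C) alone suffices, since moving a
factor t from each point of C to each point of B \ C can only increase the weight. The parameter t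
pays for C ranging over all terms, while D ranges only over terms near C. -/
theorem pow_card_le_sum {c t : ℝ} (hc : 0 ≤ c) (ht : 1 ≤ t) (x : Cube n) :
    c ^ (f.localMins x \ f.isolatedMins x).card ≤
      ∑ C : Finset (Fin f.size), ∑ D ∈ (C.biUnion f.near).powerset,
        (c / t) ^ C.card * (c * t) ^ D.card *
        cubeInd (fun x => (Disjoint C D ∧ ∀ i ∈ C ∪ D, ∀ j ∈ C ∪ D, i ≠ j → i ∉ f.nbr j) ∧
          f.SatAll (C ∪ D) x) x := by
  classical
  set B := f.localMins x \ f.isolatedMins x with hB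
  have ht0 : 0 < t := by linarith
  have hBA : ∀ {i}, i ∈ B → i ∈ f.localMins x := fun h => (Finset.mem_sdiff.1 h).1
  have hnon : ∀ a ∈ B, ∃ b ∈ B, b ≠ a ∧ b ∈ f.near a := by
    intro a ha
    have ha2 := (Finset.mem_sdiff.1 ha).2
    simp only [isolatedMins, Finset.mem_filter, not_and, not_forall] at ha2
    obtain ⟨b, hb, hba, hne⟩ := ha2 (hBA ha)
    refine ⟨b, Finset.mem_sdiff.2 ⟨hb, fun h => ?_⟩, hne, hba⟩
    exact hne ((Finset.mem_filter.1 h).2 a (hBA ha) (mem_near_comm.1 hba)).symm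
  obtain ⟨C, hCB, hdom, hcard⟩ := exists_dominating_subset B (R := fun b a => b ∈ f.near a)
    (fun _ _ => mem_near_comm.1) hnon
  have hD : B \ C ∈ (C.biUnion f.near).powerset := by
    rw [Finset.mem_powerset]
    intro a ha
    obtain ⟨c, hc, hca⟩ := hdom a ha
    exact Finset.mem_biUnion.2 ⟨c, hc, mem_near_comm.1 hca⟩
  have hnn : ∀ C D : Finset (Fin f.size), 0 ≤ (c / t) ^ C.card * (c * t) ^ D.card *
      cubeInd (fun x => (Disjoint C D ∧ ∀ i ∈ C ∪ D, ∀ j ∈ C ∪ D, i ≠ j → i ∉ f.nbr j) ∧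
        f.SatAll (C ∪ D) x) x := fun C D => by
    have := cubeInd_nonneg (fun x =>
      (Disjoint C D ∧ ∀ i ∈ C ∪ D, ∀ j ∈ C ∪ D, i ≠ j → i ∉ f.nbr j) ∧
        f.SatAll (C ∪ D) x) x
    positivity
  refine le_trans ?_ (Finset.single_le_sum
    (fun C _ => Finset.sum_nonneg fun D _ => hnn C D) (Finset.mem_univ C))
  refine le_trans ?_ (Finset.single_le_sum (fun D _ => hnn C D) hD)
  rw [cubeInd_of_pos, mul_one]
  · have hle := Finset.card_le_card hCB
    rw [Finset.card_sdiff_of_subset hCB, div_pow, mul_pow]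
    have h1 : c ^ B.card = c ^ C.card * c ^ (B.card - C.card) := by
      rw [← pow_add]; congr 1; omega
    have h2 : t ^ C.card ≤ t ^ (B.card - C.card) := pow_le_pow_right₀ ht (by omega)
    rw [div_mul_eq_mul_div, le_div_iff₀ (by positivity), h1]
    calc c ^ C.card * c ^ (B.card - C.card) * t ^ C.card
        ≤ c ^ C.card * c ^ (B.card - C.card) * t ^ (B.card - C.card) := by gcongr
      _ = _ := by ring
  · rw [Finset.union_sdiff_of_subset hCB]
    exact ⟨⟨Finset.disjoint_sdiff, fun i hi j hj => notMem_nbr_of_localMins (hBA hi) (hBA hj)⟩,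
      fun j hj => (mem_localMins.1 (hBA hj)).1⟩

/-- The sum over D is at most (1 + ctq)^(Δ|C|) ≤ 2^|C|, and then the sum over C is at most (1 +
2cq/t)^size. -/
theorem cubeMean_pow_card_nonisolated_le (hf : f.ExactWidth w) (hΔ : ∀ j, (f.near j).card ≤ Δ)
    {c t : ℝ} (hc : 0 ≤ c) (ht : 1 ≤ t) (h2 : (1 + c * t * 2⁻¹ ^ w) ^ Δ ≤ 2) :
    cubeMean (fun x => c ^ (f.localMins x \ f.isolatedMins x).card) ≤
      Real.exp (f.size * (2 * c * 2⁻¹ ^ w / t)) := by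
  classical
  have ht0 : 0 < t := by linarith
  set q : ℝ := 2⁻¹ ^ w with hq
  have hq0 : 0 < q := by positivity
  refine (cubeMean_mono (pow_card_le_sum hc ht)).trans ?_
  rw [cubeMean_sum]
  have hC : ∀ C : Finset (Fin f.size), cubeMean (fun x => ∑ D ∈ (C.biUnion f.near).powerset,
        (c / t) ^ C.card * (c * t) ^ D.card *
        cubeInd (fun x => (Disjoint C D ∧ ∀ i ∈ C ∪ D, ∀ j ∈ C ∪ D, i ≠ j → i ∉ f.nbr j) ∧
          f.SatAll (C ∪ D) x) x) ≤ (2 * c * q / t) ^ C.card := by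
    intro C
    rw [cubeMean_sum]
    have hD : ∀ D ∈ (C.biUnion f.near).powerset, cubeMean (fun x =>
        (c / t) ^ C.card * (c * t) ^ D.card *
        cubeInd (fun x => (Disjoint C D ∧ ∀ i ∈ C ∪ D, ∀ j ∈ C ∪ D, i ≠ j → i ∉ f.nbr j) ∧
          f.SatAll (C ∪ D) x) x) ≤ (c * q / t) ^ C.card * (c * t * q) ^ D.card := by
      intro D _
      rw [cubeMean_const_mul]
      refine (mul_le_mul_of_nonneg_left (cubeProb_satAll_union_le hf C D)
        (by positivity)).trans (le_of_eq ?_)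
      rw [mul_mul_mul_comm, ← mul_pow, ← mul_pow]
      congr 2
      ring
    refine (Finset.sum_le_sum hD).trans ?_
    rw [← Finset.mul_sum, sum_powerset_pow, show 2 * c * q / t = c * q / t * 2 by ring, mul_pow]
    refine mul_le_mul_of_nonneg_left ?_ (by positivity)
    have hcard : (C.biUnion f.near).card ≤ Δ * C.card := by
      rw [mul_comm]
      exact Finset.card_biUnion_le_card_mul _ _ _ fun j _ => hΔ j
    have h1 : (1 : ℝ) ≤ 1 + c * t * q := by
      have : 0 ≤ c * t * q := by positivity
      linarith
    refine (pow_le_pow_right₀ h1 hcard).trans ?_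
    rw [pow_mul]
    exact pow_le_pow_left₀ (by positivity) h2 _
  refine (Finset.sum_le_sum fun C _ => hC C).trans ?_
  rw [← Finset.powerset_univ, sum_powerset_pow, Finset.card_univ, Fintype.card_fin,
    Real.exp_nat_mul]
  refine pow_le_pow_left₀ (by positivity) ?_ _
  linarith [Real.add_one_le_exp (2 * c * q / t)]

theorem cubeMean_choose_sq_le (hf : f.ExactWidth w) (hΔ : ∀ j, (f.near j).card ≤ Δ)
    {t : ℝ} (ht : 1 ≤ t) (h2 : (1 + 64 * t * 2⁻¹ ^ w) ^ Δ ≤ 2) (d : ℕ) :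
    cubeMean (fun x => ((f.localMins x).card.choose d : ℝ) ^ 2) ≤
      2⁻¹ ^ d * (Real.exp (63 * ∑ j, cubeProb (f.IsLocalMin j)) +
        Real.exp (f.size * (2 * 64 * 2⁻¹ ^ w / t))) := by
  classical
  have hpt : ∀ x, ((f.localMins x).card.choose d : ℝ) ^ 2 ≤ 2⁻¹ ^ d *
      ((1 + 63) ^ (f.isolatedMins x).card + 64 ^ (f.localMins x \ f.isolatedMins x).card) := by
    intro x
    set M := (f.localMins x).card with hM
    by_cases hd : M < d
    · rw [Nat.choose_eq_zero_of_lt hd, Nat.cast_zero, zero_pow two_ne_zero]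
      positivity
    · have hMsum : M = (f.isolatedMins x).card + (f.localMins x \ f.isolatedMins x).card := by
        have hsub : f.isolatedMins x ⊆ f.localMins x := Finset.filter_subset _ _
        have := Finset.card_sdiff_add_card_eq_card hsub
        omega
      have h1 : (M.choose d : ℝ) ≤ 2 ^ M := by exact_mod_cast Nat.choose_le_two_pow M d
      -- For M ≥ d, binom(M, d)² ≤ 4^M ≤ 2^(-d) 8^M. With M = a + b, 8^a 8^b ≤ 64^a + 64^b separates
      -- isolated from clustered minima without any independence.
      have h3 : (M.choose d : ℝ) ^ 2 ≤ 2⁻¹ ^ d * 8 ^ M := by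
        calc (M.choose d : ℝ) ^ 2 ≤ (2 ^ M) ^ 2 := by gcongr
          _ = 2⁻¹ ^ M * 8 ^ M := by
            rw [← mul_pow, ← pow_mul, mul_comm M 2, pow_mul]; norm_num
          _ ≤ 2⁻¹ ^ d * 8 ^ M := by
            gcongr ?_ * _
            exact pow_le_pow_of_le_one (by norm_num) (by norm_num) (by omega)
      refine h3.trans ?_
      gcongr
      rw [hMsum, pow_add]
      set a := (f.isolatedMins x).card
      set b := (f.localMins x \ f.isolatedMins x).card
      have ha : ((1 : ℝ) + 63) ^ a = (8 ^ a) ^ 2 := by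
        rw [← pow_mul, mul_comm a 2, pow_mul]; norm_num
      have hb : (64 : ℝ) ^ b = (8 ^ b) ^ 2 := by
        rw [← pow_mul, mul_comm b 2, pow_mul]; norm_num
      rw [ha, hb]
      nlinarith [sq_nonneg ((8 : ℝ) ^ a - 8 ^ b), sq_nonneg ((8 : ℝ) ^ a + 8 ^ b)]
  refine (cubeMean_mono hpt).trans ?_
  rw [cubeMean_const_mul, cubeMean_add]
  gcongr
  · exact cubeMean_pow_card_isolatedMins_le (by norm_num)
  · exact cubeMean_pow_card_nonisolated_le hf hΔ (by norm_num) ht h2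

end Moments

end DNF

/-! ### Doubly truncated inclusion-exclusion -/

theorem card_filter_card_le_mul_pow_le {α : Type*} (X : Finset α) (m : ℕ) {θ : ℝ} (h0 : 0 ≤ θ)
    (h1 : θ ≤ 1) :
    ((X.powerset.filter fun U => U.card ≤ m).card : ℝ) * θ ^ m ≤ Real.exp (X.card * θ) := by
  calc ((X.powerset.filter fun U => U.card ≤ m).card : ℝ) * θ ^ m
      = ∑ U ∈ X.powerset.filter fun U => U.card ≤ m, θ ^ m := by
        rw [Finset.sum_const, nsmul_eq_mul]
    _ ≤ ∑ U ∈ X.powerset.filter fun U => U.card ≤ m, θ ^ U.card :=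
        Finset.sum_le_sum fun U hU => pow_le_pow_of_le_one h0 h1 (Finset.mem_filter.1 hU).2
    _ ≤ ∑ U ∈ X.powerset, θ ^ U.card :=
        Finset.sum_le_sum_of_subset_of_nonneg (Finset.filter_subset _ _) fun _ _ _ => by positivity
    _ = (1 + θ) ^ X.card := sum_powerset_pow θ X
    _ ≤ Real.exp θ ^ X.card :=
        pow_le_pow_left₀ (by linarith) (by linarith [Real.add_one_le_exp θ]) _
    _ = _ := (Real.exp_nat_mul _ _).symm

namespace DNF
variable {n : ℕ} {f : DNF n}

variable (f) in
/-- The truncated inclusion-exclusion sum over the sets of at most `d` local minima. -/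
noncomputable def localMinSum (d : ℕ) (x : Cube n) : ℝ :=
  ∑ J ∈ Finset.univ.powerset.filter fun J : Finset (Fin f.size) => J.card ≤ d,
    (-1) ^ J.card * cubeInd (fun x => ∀ j ∈ J, f.IsLocalMin j x) x

variable (f) in
/-- The sum `localMinSum` with each condition that no neighbour of smaller index is satisfied
replaced by its inclusion-exclusion sum, truncated at `m`. -/
noncomputable def satSum (d m : ℕ) (x : Cube n) : ℝ :=
  ∑ J ∈ Finset.univ.powerset.filter fun J : Finset (Fin f.size) => J.card ≤ d,
    ∑ U ∈ (J.biUnion f.pred).powerset.filter fun U => U.card ≤ m,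
      ((-1) ^ J.card * (-1) ^ U.card) * cubeInd (f.SatAll (J ∪ U)) x

theorem sum_filter_mul_cubeInd {α : Type*} [DecidableEq α] {s A : Finset α} {p : Finset α → Prop}
    [DecidablePred p] (h : Finset α → ℝ) (P : Finset α → Cube n → Prop) (x : Cube n)
    (hP : ∀ U ⊆ s, P U x ↔ U ⊆ A) (hA : A ⊆ s) :
    ∑ U ∈ s.powerset.filter p, h U * cubeInd (P U) x = ∑ U ∈ A.powerset.filter p, h U := by
  rw [← Finset.sum_subset (Finset.filter_subset_filter p (Finset.powerset_mono.2 hA))]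
  · refine Finset.sum_congr rfl fun U hU => ?_
    have hUA := Finset.mem_powerset.1 (Finset.mem_filter.1 hU).1
    rw [cubeInd_of_pos ((hP U (hUA.trans hA)).2 hUA), mul_one]
  · intro U hU hU'
    rw [Finset.mem_filter, Finset.mem_powerset] at hU hU'
    rw [cubeInd_of_neg, mul_zero]
    exact fun hc => hU' ⟨(hP U hU.1).1 hc, hU.2⟩

theorem one_sub_toFun (x : Cube n) :
    1 - f.toFun x = if f.localMins x = ∅ then 1 else 0 := by
  rw [toFun]
  by_cases h : ∃ j, (f.term j).Sat x
  · rw [if_pos h, if_neg, sub_self]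
    rw [localMins_eq_empty_iff]
    obtain ⟨j, hj⟩ := h
    exact fun hc => hc j (Finset.mem_univ _) hj
  · rw [if_neg h, if_pos, sub_zero]
    rw [localMins_eq_empty_iff]
    exact fun j _ hj => h ⟨j, hj⟩

theorem abs_one_sub_toFun_sub_localMinSum_le (d : ℕ) (x : Cube n) :
    |1 - f.toFun x - f.localMinSum d x| ≤ (f.localMins x).card.choose d := by
  classical
  rw [one_sub_toFun, localMinSum, sum_filter_mul_cubeInd (A := f.localMins x) _ _ x
    (fun J _ => ⟨fun h j hj => mem_localMins.2 (h j hj), fun h j hj => mem_localMins.1 (h hj)⟩)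
    (Finset.subset_univ _)]
  exact abs_bonferroni_le _ d

theorem cubeInd_satAll_union [DecidableEq (Fin f.size)] (J U : Finset (Fin f.size)) (x : Cube n) :
    cubeInd (f.SatAll (J ∪ U)) x = cubeInd (f.SatAll J) x * cubeInd (f.SatAll U) x := by
  rw [← cubeInd_and]
  refine cubeInd_congr ?_
  simp only [SatAll, Finset.mem_union, or_imp, forall_and]

theorem cubeInd_localMin_eq (J : Finset (Fin f.size)) (x : Cube n) :
    cubeInd (fun x => ∀ j ∈ J, f.IsLocalMin j x) x =
      cubeInd (f.SatAll J) x * cubeInd (f.SatNone (J.biUnion f.pred)) x := by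
  rw [← cubeInd_and]
  refine cubeInd_congr ?_
  simp only [IsLocalMin, SatAll, SatNone, Finset.mem_biUnion]
  exact ⟨fun h => ⟨fun j hj => (h j hj).1, fun i ⟨j, hj, hi⟩ => (h j hj).2 i hi⟩,
    fun h j hj => ⟨h.1 j hj, fun i hi => h.2 i ⟨j, hj, hi⟩⟩⟩

/-- Bonferroni applied to the satisfied terms of `N`: the error binomial counts the `m`-subsets all
of whose terms are satisfied. -/
theorem abs_cubeInd_satNone_sub_le (N : Finset (Fin f.size)) (m : ℕ) (x : Cube n) :
    |cubeInd (f.SatNone N) x - ∑ U ∈ N.powerset.filter (fun U => U.card ≤ m),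
      (-1) ^ U.card * cubeInd (f.SatAll U) x| ≤
      ∑ U ∈ N.powerset.filter (fun U => U.card = m), cubeInd (f.SatAll U) x := by
  classical
  set A := N.filter fun j => (f.term j).Sat x with hA
  have hAN : A ⊆ N := Finset.filter_subset _ _
  have hiff : ∀ U ⊆ N, f.SatAll U x ↔ U ⊆ A := fun U hU =>
    ⟨fun h j hj => Finset.mem_filter.2 ⟨hU hj, h j hj⟩,
      fun h j hj => (Finset.mem_filter.1 (h hj)).2⟩
  have h1 : cubeInd (f.SatNone N) x = if A = ∅ then 1 else 0 := by
    have : f.SatNone N x ↔ A = ∅ := by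
      rw [hA, Finset.filter_eq_empty_iff]
      rfl
    by_cases h : f.SatNone N x
    · rw [cubeInd_of_pos h, if_pos (this.1 h)]
    · rw [cubeInd_of_neg h, if_neg fun hc => h (this.2 hc)]
  have h2 := sum_filter_mul_cubeInd (p := fun U => U.card = m) (fun _ => 1) f.SatAll x hiff hAN
  simp only [one_mul] at h2
  rw [h1, sum_filter_mul_cubeInd _ f.SatAll x hiff hAN, h2, Finset.sum_const, nsmul_one]
  refine (abs_bonferroni_le A m).trans (le_of_eq ?_)
  rw [← Finset.card_powersetCard, Finset.powersetCard_eq_filter]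

theorem abs_localMinSum_sub_satSum_le (d m : ℕ) (x : Cube n) :
    |f.localMinSum d x - f.satSum d m x| ≤
      ∑ J ∈ Finset.univ.powerset.filter fun J : Finset (Fin f.size) => J.card ≤ d,
        ∑ U ∈ (J.biUnion f.pred).powerset.filter fun U => U.card = m,
          cubeInd (f.SatAll U) x := by
  rw [localMinSum, satSum, ← Finset.sum_sub_distrib]
  refine (Finset.abs_sum_le_sum_abs _ _).trans (Finset.sum_le_sum fun J _ => ?_)
  have h : (-1) ^ J.card * cubeInd (fun x => ∀ j ∈ J, f.IsLocalMin j x) x -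
      ∑ U ∈ (J.biUnion f.pred).powerset.filter (fun U => U.card ≤ m),
        ((-1) ^ J.card * (-1) ^ U.card) * cubeInd (f.SatAll (J ∪ U)) x =
      (-1) ^ J.card * (cubeInd (f.SatAll J) x * (cubeInd (f.SatNone (J.biUnion f.pred)) x -
        ∑ U ∈ (J.biUnion f.pred).powerset.filter (fun U => U.card ≤ m),
          (-1) ^ U.card * cubeInd (f.SatAll U) x)) := by
    rw [cubeInd_localMin_eq, mul_sub, mul_sub, Finset.mul_sum, Finset.mul_sum]
    congr 1
    refine Finset.sum_congr rfl fun U _ => ?_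
    rw [cubeInd_satAll_union]
    ring
  rw [h, abs_mul, abs_pow, abs_neg, abs_one, one_pow, one_mul, abs_mul]
  refine le_trans ?_ (abs_cubeInd_satNone_sub_le _ m x)
  refine mul_le_of_le_one_left (abs_nonneg _) ?_
  unfold cubeInd
  split_ifs <;> simp

section Bounds
variable {d m v : ℕ} {K₁ K₂ : ℝ}

/-- Cauchy-Schwarz over the at most K₁K₂ pairs (J, U) bounds the squared error by their number times
a sum of indicators, each of mean at most 2^(-v). -/
theorem cubeMean_localMinSum_sub_satSum_sq_le
    (hK₁ : ((Finset.univ.powerset.filter fun J : Finset (Fin f.size) => J.card ≤ d).card : ℝ) ≤ K₁)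
    (hK₂ : ∀ J : Finset (Fin f.size), J.card ≤ d →
      (((J.biUnion f.pred).powerset.filter fun U => U.card ≤ m).card : ℝ) ≤ K₂)
    (hv : ∀ U : Finset (Fin f.size), U.card = m → v ≤ (f.varsOf U).card) :
    cubeMean (fun x => (f.localMinSum d x - f.satSum d m x) ^ 2) ≤ (K₁ * K₂) ^ 2 * 2⁻¹ ^ v := by
  classical
  set I := (Finset.univ.powerset.filter fun J : Finset (Fin f.size) => J.card ≤ d).sigma
    fun J => (J.biUnion f.pred).powerset.filter fun U => U.card = m with hI
  have hIcard : (I.card : ℝ) ≤ K₁ * K₂ := by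
    rw [hI, Finset.card_sigma]
    push_cast
    have h : ∀ J ∈ Finset.univ.powerset.filter (fun J : Finset (Fin f.size) => J.card ≤ d),
        (((J.biUnion f.pred).powerset.filter fun U => U.card = m).card : ℝ) ≤ K₂ := by
      intro J hJ
      refine le_trans ?_ (hK₂ J (Finset.mem_filter.1 hJ).2)
      exact_mod_cast Finset.card_le_card
        (Finset.monotone_filter_right _ fun U _ hU => le_of_eq hU)
    refine (Finset.sum_le_card_nsmul _ _ _ h).trans ?_
    rw [nsmul_eq_mul]
    refine mul_le_mul_of_nonneg_right hK₁ ?_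
    exact (Nat.cast_nonneg _).trans (hK₂ ∅ (by simp))
  have hpt : ∀ x, (f.localMinSum d x - f.satSum d m x) ^ 2 ≤
      I.card * ∑ i ∈ I, cubeInd (f.SatAll i.2) x := by
    intro x
    have h1 := abs_localMinSum_sub_satSum_le (f := f) d m x
    rw [Finset.sum_sigma' _ _ fun _ U => cubeInd (f.SatAll U) x] at h1
    rw [← sq_abs]
    refine (pow_le_pow_left₀ (abs_nonneg _) h1 2).trans ?_
    refine sq_sum_le_card_mul_sum_sq.trans (le_of_eq ?_)
    congr 1
    refine Finset.sum_congr rfl fun i _ => ?_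
    unfold cubeInd
    split_ifs <;> simp
  refine (cubeMean_mono hpt).trans ?_
  rw [cubeMean_const_mul, cubeMean_sum]
  have hterm : ∀ i ∈ I, cubeMean (cubeInd (f.SatAll i.2)) ≤ 2⁻¹ ^ v := by
    intro i hi
    refine (f.cubeProb_satAll_le i.2).trans ?_
    exact pow_le_pow_of_le_one (by norm_num) (by norm_num)
      (hv _ (Finset.mem_filter.1 (Finset.mem_sigma.1 hi).2).2)
  have hsum := Finset.sum_le_card_nsmul _ _ _ hterm
  rw [nsmul_eq_mul] at hsum
  calc (I.card : ℝ) * ∑ i ∈ I, cubeMean (cubeInd (f.SatAll i.2))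
      ≤ I.card * (I.card * 2⁻¹ ^ v) := by gcongr
    _ = (I.card : ℝ) ^ 2 * 2⁻¹ ^ v := by ring
    _ ≤ _ := by gcongr

theorem sum_abs_fourierCoef_satSum_le
    (hK₁ : ((Finset.univ.powerset.filter fun J : Finset (Fin f.size) => J.card ≤ d).card : ℝ) ≤ K₁)
    (hK₂ : ∀ J : Finset (Fin f.size), J.card ≤ d →
      (((J.biUnion f.pred).powerset.filter fun U => U.card ≤ m).card : ℝ) ≤ K₂) :
    ∑ S, |fourierCoef (f.satSum d m) S| ≤ K₁ * K₂ := by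
  have h1 : ∀ S, |fourierCoef (f.satSum d m) S| ≤
      ∑ J ∈ Finset.univ.powerset.filter (fun J : Finset (Fin f.size) => J.card ≤ d),
        ∑ U ∈ (J.biUnion f.pred).powerset.filter (fun U => U.card ≤ m),
          |fourierCoef (cubeInd (f.SatAll (J ∪ U))) S| := by
    intro S
    unfold satSum
    rw [fourierCoef_sum]
    refine (Finset.abs_sum_le_sum_abs _ _).trans (Finset.sum_le_sum fun J _ => ?_)
    rw [fourierCoef_sum]
    refine (Finset.abs_sum_le_sum_abs _ _).trans (Finset.sum_le_sum fun U _ => ?_)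
    rw [fourierCoef_const_mul, abs_mul, abs_mul, abs_pow, abs_pow, abs_neg, abs_one, one_pow,
      one_pow, one_mul, one_mul]
  refine (Finset.sum_le_sum fun S _ => h1 S).trans ?_
  rw [Finset.sum_comm]
  have h2 : ∀ J ∈ Finset.univ.powerset.filter (fun J : Finset (Fin f.size) => J.card ≤ d),
      ∑ S, ∑ U ∈ (J.biUnion f.pred).powerset.filter (fun U => U.card ≤ m),
        |fourierCoef (cubeInd (f.SatAll (J ∪ U))) S| ≤ K₂ := by
    intro J hJ
    rw [Finset.sum_comm]
    refine (Finset.sum_le_card_nsmul _ _ 1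
      fun U _ => f.sum_abs_fourierCoef_satAll_le (J ∪ U)).trans ?_
    rw [nsmul_one]
    exact hK₂ J (Finset.mem_filter.1 hJ).2
  refine (Finset.sum_le_card_nsmul _ _ _ h2).trans ?_
  rw [nsmul_eq_mul]
  exact mul_le_mul_of_nonneg_right hK₁ ((Nat.cast_nonneg _).trans (hK₂ ∅ (by simp)))

end Bounds

end DNF

/-! ### Numerical estimates and the choice of parameters -/

theorem eight_pow_le_two_pow {w : ℕ} (hw : 100 ≤ w) : 128 * w ^ 8 ≤ 2 ^ w := by
  induction w, hw using Nat.le_induction with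
  | base => norm_num
  | succ w hw ih =>
    have h : (w + 1) ^ 8 ≤ 2 * w ^ 8 := by
      have h1 : 100 * (w + 1) ≤ 101 * w := by omega
      have h2 := Nat.pow_le_pow_left h1 8
      rw [mul_pow, mul_pow] at h2
      have h3 : 101 ^ 8 ≤ 2 * 100 ^ 8 := by norm_num
      have h4 := Nat.mul_le_mul_right (w ^ 8) h3
      have h5 : 100 ^ 8 * (w + 1) ^ 8 ≤ 100 ^ 8 * (2 * w ^ 8) := by linarith
      exact Nat.le_of_mul_le_mul_left h5 (by norm_num)
    rw [pow_succ 2]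
    omega

theorem exp_one_le_four : Real.exp 1 ≤ 4 := by linarith [Real.exp_one_lt_d9]

theorem exp_nat_le (m : ℕ) : Real.exp m ≤ 2 ^ (2 * m) := by
  rw [← Real.exp_one_pow, pow_mul]
  exact pow_le_pow_left₀ (Real.exp_pos _).le (by linarith [exp_one_le_four]) _

theorem exp_two_mul_nat_le (m : ℕ) : Real.exp (2 * m) ≤ 2 ^ (3 * m) := by
  rw [mul_comm (2 : ℝ), Real.exp_nat_mul, pow_mul]
  refine pow_le_pow_left₀ (Real.exp_pos _).le ?_ _
  rw [show (2 : ℝ) = 1 + 1 by norm_num, Real.exp_add]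
  nlinarith [Real.exp_one_lt_d9, Real.exp_pos 1]

namespace DNF
variable {n : ℕ} {f : DNF n} {w k l : ℕ}

theorem dependsOn_toFun : DependsOn f.toFun (f.varsOf Finset.univ : Set (Fin n)) := by
  intro x y h
  have : (∃ j, (f.term j).Sat x) ↔ ∃ j, (f.term j).Sat y := exists_congr fun j =>
    iff_of_eq ((f.term j).dependsOn_sat fun i hi => h i (vars_subset_varsOf (Finset.mem_univ j) hi))
  unfold toFun
  by_cases hx : ∃ j, (f.term j).Sat x
  · rw [if_pos hx, if_pos (this.1 hx)]
  · rw [if_neg hx, if_neg fun hy => hx (this.2 hy)]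

theorem concentratedOnCoeffs_two_pow_vars {ε : ℝ} (hε : 0 ≤ ε) :
    ConcentratedOnCoeffs f.toFun ε (2 ^ (f.varsOf Finset.univ).card) := by
  refine ⟨(f.varsOf Finset.univ).powerset, by rw [Finset.card_powerset]; push_cast; rfl,
    concentratedOn_of_zero_off hε fun S hS => ?_⟩
  rw [Finset.mem_powerset, Finset.not_subset] at hS
  obtain ⟨i, hiS, hi⟩ := hS
  refine fourierCoef_eq_zero hiS fun x => dependsOn_toFun fun j hj => Function.update_of_ne ?_ _ _
  rintro rfl
  exact hi (Finset.mem_coe.mp hj)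

theorem one_sub_toFun_eq_cubeInd (x : Cube n) :
    1 - f.toFun x = cubeInd (f.SatNone Finset.univ) x := by
  rw [one_sub_toFun]
  by_cases h : f.SatNone Finset.univ x
  · rw [cubeInd_of_pos h, if_pos (localMins_eq_empty_iff.2 h)]
  · rw [cubeInd_of_neg h, if_neg fun hc => h (localMins_eq_empty_iff.1 hc)]

theorem concentratedOnCoeffs_of_cubeProb_satNone_le {ε : ℝ}
    (h : cubeProb (f.SatNone Finset.univ) ≤ ε) : ConcentratedOnCoeffs f.toFun (2 * ε) 1 := by
  have := concentratedOnCoeffs_of_approx (f := f.toFun) (g := fun _ => 0) (δ := ε) (Λ := 0)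
    (τ := 1) one_pos (by
      refine (Finset.sum_eq_zero fun S _ => ?_).le
      simp [fourierCoef]) (by
      refine le_trans (le_of_eq ?_) h
      rw [cubeProb]
      congr 1
      funext x
      rw [sub_zero, one_sub_toFun_eq_cubeInd]
      unfold cubeInd
      split_ifs <;> simp)
  simpa using this

theorem ConcentratedOnCoeffs.mono {g : Cube n → ℝ} {ε ε' M M' : ℝ}
    (h : ConcentratedOnCoeffs g ε M) (hε : ε ≤ ε') (hM : M ≤ M') :
    ConcentratedOnCoeffs g ε' M' := by
  obtain ⟨F, hF, hc⟩ := h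
  exact ⟨F, hF.trans hM, le_trans hc hε⟩

/-- Comparing e^(-l) with the bound e^(-bq) from a disjoint family gives bq ≤ l, and that family
covers the formula up to a factor wk ≤ w². -/
theorem size_mul_le (hf : f.ExactWidth w) (hw : 1 ≤ w) (hk : f.HasRead k) (hkw : k ≤ w)
    (hl : Real.exp (-l) ≤ cubeProb (f.SatNone Finset.univ)) :
    (f.size : ℝ) * 2⁻¹ ^ w ≤ w ^ 2 * l := by
  obtain ⟨b, hb, hprob⟩ := cubeProb_satNone_le_exp_size hf (card_nbr_le hw hf hk)
  have h1 := Real.exp_le_exp.1 (hl.trans hprob)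
  have h2 : (f.size : ℝ) ≤ b * w ^ 2 := by
    have : f.size ≤ b * w ^ 2 := hb.trans (Nat.mul_le_mul_left _ (by
      rw [sq]; exact Nat.mul_le_mul_left _ hkw))
    exact_mod_cast this
  calc (f.size : ℝ) * 2⁻¹ ^ w ≤ b * w ^ 2 * 2⁻¹ ^ w := by gcongr
    _ = w ^ 2 * (b * 2⁻¹ ^ w) := by ring
    _ ≤ w ^ 2 * l := by gcongr; linarith

section LargeWidth

theorem card_near_le_pow (hf : f.ExactWidth w) (hw : 1 ≤ w) (hk : f.HasRead k) (hkw : k ≤ w)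
    (j : Fin f.size) : (f.near j).card ≤ w ^ 6 := by
  refine (card_near_le hw hf hk j).trans ?_
  calc (w * k) ^ 3 ≤ (w * w) ^ 3 := Nat.pow_le_pow_left (Nat.mul_le_mul_left _ hkw) 3
    _ = w ^ 6 := by ring

theorem pow_mul_inv_two_pow_le (hw : 100 ≤ w) : (w : ℝ) ^ 8 * 2⁻¹ ^ w ≤ 1 / 128 := by
  have h : (128 : ℝ) * w ^ 8 ≤ 2 ^ w := by exact_mod_cast eight_pow_le_two_pow hw
  rw [inv_pow, ← div_eq_mul_inv, div_le_iff₀ (by positivity)]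
  linarith

/-- The Poisson bound read backwards; its total correction (size · q)(2w⁶q) ≤ 2l w⁸q is at most l.
-/
theorem sum_cubeProb_isLocalMin_le (hf : f.ExactWidth w) (hw : 100 ≤ w) (hk : f.HasRead k)
    (hkw : k ≤ w) (hl : Real.exp (-l) ≤ cubeProb (f.SatNone Finset.univ)) :
    ∑ j, cubeProb (f.IsLocalMin j) ≤ 2 * l := by
  have hs := size_mul_le hf (by omega) hk hkw hl
  have hq := pow_mul_inv_two_pow_le hw
  have hw1 : (1 : ℝ) ≤ w := by exact_mod_cast (by omega : 1 ≤ w)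
  set q : ℝ := 2⁻¹ ^ w with hqdef
  have hq0 : 0 < q := by positivity
  have h6 : ((w ^ 6 : ℕ) : ℝ) * q ≤ 1 / 8 := by
    push_cast
    have : (w : ℝ) ^ 6 ≤ w ^ 8 := pow_le_pow_right₀ hw1 (by norm_num)
    nlinarith
  have h := Real.exp_le_exp.1 (hl.trans
    (cubeProb_satNone_le_exp hf (by omega) (card_near_le_pow hf (by omega) hk hkw) h6))
  rw [Finset.sum_add_distrib, Finset.sum_neg_distrib, Finset.sum_const, Finset.card_univ,
    Fintype.card_fin, nsmul_eq_mul] at h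
  rw [← hqdef] at h
  push_cast at h
  have h2 : (f.size : ℝ) * (2 * w ^ 6 * q ^ 2) ≤ l := by
    calc (f.size : ℝ) * (2 * w ^ 6 * q ^ 2) = (f.size * q) * (2 * w ^ 6 * q) := by ring
      _ ≤ (w ^ 2 * l) * (2 * w ^ 6 * q) := by gcongr
      _ = l * (2 * (w ^ 8 * q)) := by ring
      _ ≤ l * 1 := by gcongr; linarith
      _ = l := mul_one _
  linarith

theorem cubeMean_one_sub_sub_localMinSum_sq_le (hf : f.ExactWidth w) (hw : 100 ≤ w)
    (hk : f.HasRead k) (hkw : k ≤ w)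
    (hl : Real.exp (-l) ≤ cubeProb (f.SatNone Finset.univ)) (d : ℕ) :
    cubeMean (fun x => (1 - f.toFun x - f.localMinSum d x) ^ 2) ≤
      2⁻¹ ^ d * (2 * 2 ^ (192 * l)) := by
  have hs := size_mul_le hf (by omega) hk hkw hl
  have hq := pow_mul_inv_two_pow_le hw
  have hw1 : (1 : ℝ) ≤ w := by exact_mod_cast (by omega : 1 ≤ w)
  have ht : (1 : ℝ) ≤ w ^ 2 := one_le_pow₀ hw1
  -- The tilt is t = w²: small enough for this bound, since 64 w⁸ q ≤ 1/2, and large enough to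
  -- cancel the w² in size · q ≤ w² l.
  have h2 : (1 + 64 * (w : ℝ) ^ 2 * 2⁻¹ ^ w) ^ (w ^ 6) ≤ 2 := by
    have h3 : (1 + 64 * (w : ℝ) ^ 2 * 2⁻¹ ^ w) ^ (w ^ 6) ≤
        Real.exp (64 * (w : ℝ) ^ 2 * 2⁻¹ ^ w) ^ (w ^ 6) := by
      refine pow_le_pow_left₀ (by positivity) ?_ _
      linarith [Real.add_one_le_exp (64 * (w : ℝ) ^ 2 * 2⁻¹ ^ w)]
    rw [← Real.exp_nat_mul] at h3
    refine h3.trans ?_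
    have h4 : ((w ^ 6 : ℕ) : ℝ) * (64 * (w : ℝ) ^ 2 * 2⁻¹ ^ w) ≤ 1 / 2 := by
      push_cast
      linarith
    refine (Real.exp_le_exp.2 h4).trans ?_
    have h5 : Real.exp (1 / 2) ^ 2 = Real.exp 1 := by
      rw [← Real.exp_nat_mul]; norm_num
    nlinarith [exp_one_le_four, Real.exp_pos (1 / 2)]
  have hM := cubeMean_choose_sq_le hf (card_near_le_pow hf (by omega) hk hkw) ht h2 d
  refine le_trans (cubeMean_mono fun x => ?_) (hM.trans ?_)
  · rw [← sq_abs]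
    exact pow_le_pow_left₀ (abs_nonneg _) (abs_one_sub_toFun_sub_localMinSum_le d x) 2
  · have h3 := sum_cubeProb_isLocalMin_le hf hw hk hkw hl
    have h4 := exp_two_mul_nat_le (64 * l)
    push_cast at h4
    rw [show 3 * (64 * l) = 192 * l by ring] at h4
    have h5 : (f.size : ℝ) * (2 * 64 * 2⁻¹ ^ w / w ^ 2) ≤ 2 * (64 * l) := by
      rw [mul_div_assoc', div_le_iff₀ (by positivity)]
      linarith
    have h6 : (0 : ℝ) ≤ l := Nat.cast_nonneg l
    rw [two_mul ((2 : ℝ) ^ (192 * l))]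
    refine mul_le_mul_of_nonneg_left (add_le_add ?_ ?_) (by positivity)
    · exact (Real.exp_le_exp.2 (by linarith)).trans h4
    · exact (Real.exp_le_exp.2 h5).trans h4

theorem card_filter_card_le_two_pow (hs : (f.size : ℝ) * 2⁻¹ ^ w ≤ w ^ 2 * l) (hw : 100 ≤ w)
    (d : ℕ) :
    ((Finset.univ.powerset.filter fun J : Finset (Fin f.size) => J.card ≤ d).card : ℝ) ≤
      2 ^ (2 * l + 2 * w * d) := by
  have hw0 : (0 : ℝ) < w := by exact_mod_cast (by omega : 0 < w)
  have hw1 : (1 : ℝ) ≤ w := by exact_mod_cast (by omega : 1 ≤ w)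
  have hw2 : (w : ℝ) ^ 2 ≤ 2 ^ w := by
    have := eight_pow_le_two_pow hw
    have h2 : w ^ 2 ≤ w ^ 8 := Nat.pow_le_pow_right (by omega) (by norm_num)
    exact_mod_cast (by omega : w ^ 2 ≤ 2 ^ w)
  -- With θ = q/w² one has size · θ ≤ l, while 1/θ = 2^w w² ≤ 4^w.
  have h := card_filter_card_le_mul_pow_le (Finset.univ : Finset (Fin f.size)) d
    (θ := 2⁻¹ ^ w / w ^ 2) (by positivity) (by
      rw [div_le_one (by positivity)]
      exact (pow_le_one₀ (by norm_num) (by norm_num)).trans (one_le_pow₀ hw1))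
  rw [Finset.card_univ, Fintype.card_fin] at h
  have h1 : (f.size : ℝ) * (2⁻¹ ^ w / w ^ 2) ≤ l := by
    rw [mul_div_assoc', div_le_iff₀ (by positivity)]
    linarith
  have h2 := h.trans ((Real.exp_le_exp.2 h1).trans (exp_nat_le l))
  have h3 : ((2 : ℝ)⁻¹ ^ w / w ^ 2) ^ d = (((2 : ℝ) ^ w * (w : ℝ) ^ 2) ^ d)⁻¹ := by
    rw [← inv_pow, mul_inv, inv_pow, div_eq_mul_inv]
  rw [h3, ← div_eq_mul_inv, div_le_iff₀ (by positivity)] at h2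
  refine h2.trans ?_
  rw [pow_add, mul_assoc 2 w d, two_mul (w * d), pow_add, mul_pow, ← pow_mul, ← pow_mul]
  gcongr
  rw [pow_mul, pow_mul]
  exact pow_le_pow_left₀ (by positivity) hw2 d

theorem card_filter_pred_card_le (hf : f.ExactWidth w) (hw : 1 ≤ w) (hk : f.HasRead k)
    (hlog : (Real.exp 1 * w) ^ (4 * k) ≤ 2 ^ w) {d : ℕ} (J : Finset (Fin f.size))
    (hJ : J.card ≤ d) :
    (((J.biUnion f.pred).powerset.filter fun U => U.card ≤ 12 * d * k).card : ℝ) ≤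
      2 ^ (3 * w * d) := by
  have hw0 : (0 : ℝ) < w := by exact_mod_cast hw
  -- With θ = 1/w the count is at most (ew)^(12dk), because there are at most dkw predecessors. This
  -- is where the logarithm in the read condition is needed.
  have h := card_filter_card_le_mul_pow_le (J.biUnion f.pred) (12 * d * k)
    (θ := (w : ℝ)⁻¹) (by positivity) (inv_le_one_of_one_le₀ (by exact_mod_cast hw))
  have hN : (J.biUnion f.pred).card ≤ 12 * d * k * w := by
    refine (Finset.card_biUnion_le_card_mul _ _ (w * k) fun j _ =>
      (Finset.card_le_card (Finset.filter_subset _ _)).trans (card_nbr_le hw hf hk j)).trans ?_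
    calc J.card * (w * k) ≤ d * (w * k) := Nat.mul_le_mul_right _ hJ
      _ ≤ 12 * (d * (w * k)) := Nat.le_mul_of_pos_left _ (by norm_num)
      _ = _ := by ring
  have hN' : ((J.biUnion f.pred).card : ℝ) * (w : ℝ)⁻¹ ≤ ((12 * d * k : ℕ) : ℝ) := by
    rw [← div_eq_mul_inv, div_le_iff₀ hw0]
    exact_mod_cast hN
  have h2 := h.trans (Real.exp_le_exp.2 hN')
  rw [inv_pow, ← div_eq_mul_inv, div_le_iff₀ (by positivity), ← Real.exp_one_pow, ← mul_pow] at h2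
  refine h2.trans ?_
  rw [show 12 * d * k = 4 * k * (3 * d) by ring, show 3 * w * d = w * (3 * d) by ring,
    pow_mul _ (4 * k), pow_mul _ w]
  exact pow_le_pow_left₀ (by positivity) hlog _

theorem concentratedOnCoeffs_of_large_width (hf : f.ExactWidth w) (hw : 100 ≤ w)
    (hk : f.HasRead k) (hk1 : 1 ≤ k) (hkw : k ≤ w) (hlog : (Real.exp 1 * w) ^ (4 * k) ≤ 2 ^ w)
    (hl1 : 1 ≤ l) (hl : Real.exp (-l) ≤ cubeProb (f.SatNone Finset.univ)) :
    ConcentratedOnCoeffs f.toFun (2⁻¹ ^ l) (2 ^ (2010 * (w * l))) := by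
  -- The moment bound loses 2^(192l + 1), and 200l leaves room for the target 2^(-(l + 4)).
  set d := 200 * l with hd
  have hs := size_mul_le hf (by omega) hk hkw hl
  have hK₁ := card_filter_card_le_two_pow hs hw d
  have hK₂ := fun J hJ => card_filter_pred_card_le hf (by omega) hk hlog (d := d) J hJ
  -- These 12dw = 2400wl variables outweigh the squared number of pairs (J, U), which is 2^(4l +
  -- 2000wl).
  have hv : ∀ U : Finset (Fin f.size), U.card = 12 * d * k →
      12 * d * w ≤ (f.varsOf U).card := by
    intro U hU
    have := card_mul_le_varsOf hf hk U
    rw [hU] at this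
    exact Nat.le_of_mul_le_mul_right (by linarith) hk1
  have hA := cubeMean_one_sub_sub_localMinSum_sq_le hf hw hk hkw hl d
  have hB := cubeMean_localMinSum_sub_satSum_sq_le hK₁ hK₂ hv
  have hΛ := sum_abs_fourierCoef_satSum_le hK₁ hK₂
  rw [← pow_add] at hB hΛ
  have hwl : l ≤ w * l := Nat.le_mul_of_pos_left _ (by omega)
  set Λ : ℝ := 2 ^ (2 * l + 2 * w * d + 3 * w * d) with hΛdef
  have hA' : cubeMean (fun x => (1 - f.toFun x - f.localMinSum d x) ^ 2) ≤ 2⁻¹ ^ (l + 4) := by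
    refine hA.trans ?_
    rw [← pow_succ', hd, inv_pow, inv_pow, inv_mul_le_iff₀ (by positivity), ← div_eq_mul_inv,
      le_div_iff₀ (by positivity), ← pow_add]
    exact pow_le_pow_right₀ (by norm_num) (by omega)
  have hB' : cubeMean (fun x => (f.localMinSum d x - f.satSum d (12 * d * k) x) ^ 2) ≤
      2⁻¹ ^ (l + 4) := by
    refine hB.trans ?_
    rw [hΛdef, ← pow_mul, inv_pow, inv_pow, ← div_eq_mul_inv, div_le_iff₀ (by positivity),
      ← div_eq_inv_mul, le_div_iff₀ (by positivity), ← pow_add]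
    refine pow_le_pow_right₀ (by norm_num) ?_
    have e1 : 2 * w * d = 400 * (w * l) := by rw [hd]; ring
    have e2 : 3 * w * d = 600 * (w * l) := by rw [hd]; ring
    have e3 : 12 * d * w = 2400 * (w * l) := by rw [hd]; ring
    omega
  have hfg : cubeMean (fun x => (1 - f.toFun x - f.satSum d (12 * d * k) x) ^ 2) ≤
      2⁻¹ ^ (l + 2) := by
    have hpt : ∀ x, (1 - f.toFun x - f.satSum d (12 * d * k) x) ^ 2 ≤
        2 * (1 - f.toFun x - f.localMinSum d x) ^ 2 +
        2 * (f.localMinSum d x - f.satSum d (12 * d * k) x) ^ 2 := fun x => by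
      nlinarith [sq_nonneg ((1 - f.toFun x - f.localMinSum d x) -
        (f.localMinSum d x - f.satSum d (12 * d * k) x))]
    refine (cubeMean_mono hpt).trans ?_
    rw [cubeMean_add, cubeMean_const_mul, cubeMean_const_mul]
    have e : (2⁻¹ : ℝ) ^ (l + 2) = 4 * 2⁻¹ ^ (l + 4) := by
      rw [pow_add, pow_add]; ring
    rw [e]
    linarith
  have hΛ0 : 0 < Λ := by positivity
  have hmain := concentratedOnCoeffs_of_approx (τ := 2⁻¹ ^ (l + 2) / Λ) (by positivity) hΛ hfg
  refine ConcentratedOnCoeffs.mono hmain (le_of_eq ?_) ?_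
  · rw [div_mul_cancel₀ _ hΛ0.ne', pow_add]
    ring
  · have e1 : Λ / (2⁻¹ ^ (l + 2) / Λ) =
        2 ^ ((2 * l + 2 * w * d + 3 * w * d) * 2 + (l + 2)) := by
      rw [pow_add _ (_ * 2), pow_mul, ← hΛdef, inv_pow]
      field_simp
    have e2 : (1 : ℝ) ≤ 2 ^ ((2 * l + 2 * w * d + 3 * w * d) * 2 + (l + 2)) :=
      one_le_pow₀ (by norm_num)
    rw [e1]
    calc _ ≤ (2 : ℝ) ^ ((2 * l + 2 * w * d + 3 * w * d) * 2 + (l + 2)) * 2 := by linarith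
      _ = 2 ^ ((2 * l + 2 * w * d + 3 * w * d) * 2 + (l + 2) + 1) := (pow_succ _ _).symm
      _ ≤ _ := by
        refine pow_le_pow_right₀ (by norm_num) ?_
        have e1 : 2 * w * d = 400 * (w * l) := by rw [hd]; ring
        have e2 : 3 * w * d = 600 * (w * l) := by rw [hd]; ring
        have e3 : 100 * l ≤ w * l := Nat.mul_le_mul_right _ hw
        omega

end LargeWidth

end DNF

/-! ### Assembling the cases -/

namespace DNF
variable {n : ℕ} {f : DNF n} {w k l : ℕ}

/-- The condition on the read, in multiplicative form. -/
theorem exp_mul_pow_le_two_pow (hw : 1 ≤ w)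
    (h : (k : ℝ) ≤ (w : ℝ) / (4 * Real.logb 2 (Real.exp 1 * (w : ℝ)))) :
    k ≤ w ∧ (Real.exp 1 * w) ^ (4 * k) ≤ 2 ^ w := by
  have hw1 : (1 : ℝ) ≤ w := by exact_mod_cast hw
  have he : (2 : ℝ) ≤ Real.exp 1 * w := by nlinarith [Real.add_one_le_exp (1 : ℝ)]
  set a := Real.logb 2 (Real.exp 1 * (w : ℝ)) with ha
  have ha1 : 1 ≤ a := by
    rw [ha, Real.le_logb_iff_rpow_le (by norm_num) (by linarith), Real.rpow_one]
    exact he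
  rw [le_div_iff₀ (by linarith)] at h
  have hk : (0 : ℝ) ≤ k := Nat.cast_nonneg k
  refine ⟨?_, ?_⟩
  · have : (k : ℝ) ≤ w := by nlinarith
    exact_mod_cast this
  · have h2 : (2 : ℝ) ^ a = Real.exp 1 * w :=
      Real.rpow_logb (by norm_num) (by norm_num) (by linarith)
    rw [← h2, ← Real.rpow_natCast, ← Real.rpow_mul (by norm_num), ← Real.rpow_natCast 2 w]
    refine Real.rpow_le_rpow_of_exponent_le (by norm_num) ?_
    push_cast
    linarith

/-- For bounded width even the total number of variables is O(wl), so all their subsets can be kept.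
-/
theorem card_varsOf_univ_le (hf : f.ExactWidth w) (hw : 1 ≤ w) (hw2 : w ≤ 100)
    (hk : f.HasRead k) (hkw : k ≤ w)
    (hl : Real.exp (-l) ≤ cubeProb (f.SatNone Finset.univ)) :
    (f.varsOf Finset.univ).card ≤ 2 ^ 100 * 100 ^ 2 * (w * l) := by
  have hs := size_mul_le hf hw hk hkw hl
  rw [inv_pow, ← div_eq_mul_inv, div_le_iff₀ (by positivity)] at hs
  have hs' : f.size ≤ w ^ 2 * l * 2 ^ w := by exact_mod_cast hs
  have h := card_varsOf_le hf Finset.univ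
  rw [Finset.card_univ, Fintype.card_fin] at h
  calc (f.varsOf Finset.univ).card ≤ f.size * w := h
    _ ≤ w ^ 2 * l * 2 ^ w * w := Nat.mul_le_mul_right _ hs'
    _ = 2 ^ w * w ^ 2 * (w * l) := by ring
    _ ≤ 2 ^ 100 * 100 ^ 2 * (w * l) := by
      gcongr
      norm_num

theorem concentratedOnCoeffs_two_pow (hf : f.ExactWidth w) (hw : 1 ≤ w) (hk : f.HasRead k)
    (hkw : k ≤ w) (hlog : (Real.exp 1 * w) ^ (4 * k) ≤ 2 ^ w) (hl : 1 ≤ l) :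
    ConcentratedOnCoeffs f.toFun (2⁻¹ ^ l) (2 ^ (2 ^ 101 * 100 ^ 2 * (w * l))) := by
  have hwl : w * (l + 1) ≤ 2 * (w * l) := by nlinarith
  -- The threshold uses l + 1 because the nearly constant case loses a factor 2 in the error.
  by_cases hp : Real.exp (-(l + 1 : ℕ)) ≤ cubeProb (f.SatNone Finset.univ)
  · have hε : (2⁻¹ : ℝ) ^ (l + 1) ≤ 2⁻¹ ^ l :=
      pow_le_pow_of_le_one (by norm_num) (by norm_num) (by omega)
    rcases le_or_gt w 100 with hw2 | hw2
    · refine ConcentratedOnCoeffs.mono (concentratedOnCoeffs_two_pow_vars (by positivity)) le_rfl ?_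
      refine pow_le_pow_right₀ (by norm_num) ((card_varsOf_univ_le hf hw hw2 hk hkw hp).trans ?_)
      calc 2 ^ 100 * 100 ^ 2 * (w * (l + 1)) ≤ 2 ^ 100 * 100 ^ 2 * (2 * (w * l)) :=
            Nat.mul_le_mul_left _ hwl
        _ = _ := by ring
    · rcases Nat.eq_zero_or_pos k with rfl | hk1
      · have hs : f.size = 0 := by
          by_contra h
          have := card_nbr_le hw hf hk ⟨0, Nat.pos_of_ne_zero h⟩
          have h2 := Finset.card_pos.2 ⟨_, mem_nbr_self (f := f) ⟨0, Nat.pos_of_ne_zero h⟩⟩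
          omega
        refine ConcentratedOnCoeffs.mono (concentratedOnCoeffs_two_pow_vars (by positivity))
          le_rfl ?_
        have h := card_varsOf_le hf Finset.univ
        rw [Finset.card_univ, Fintype.card_fin] at h
        refine pow_le_pow_right₀ (by norm_num) (h.trans ?_)
        rw [hs, zero_mul]
        exact Nat.zero_le _
      · refine ConcentratedOnCoeffs.mono (concentratedOnCoeffs_of_large_width hf hw2.le hk hk1 hkw
          hlog (by omega) hp) hε (pow_le_pow_right₀ (by norm_num) ?_)
        calc 2010 * (w * (l + 1)) ≤ 2010 * (2 * (w * l)) := Nat.mul_le_mul_left _ hwl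
          _ = 4020 * (w * l) := by ring
          _ ≤ _ := Nat.mul_le_mul_right _ (by norm_num)
  · push Not at hp
    have h1 : Real.exp (-(l + 1 : ℕ)) ≤ 2⁻¹ ^ (l + 1) := by
      rw [Real.exp_neg, inv_pow, ← Real.exp_one_pow]
      gcongr
      linarith [Real.add_one_le_exp (1 : ℝ)]
    refine ConcentratedOnCoeffs.mono
      (concentratedOnCoeffs_of_cubeProb_satNone_le (hp.le.trans h1)) ?_ ?_
    · rw [pow_succ]
      linarith
    · exact one_le_pow₀ (by norm_num)

theorem toFun_sq (x : Cube n) : f.toFun x ^ 2 = f.toFun x := by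
  unfold toFun
  split_ifs <;> simp

theorem toFun_eq_cubeInd : f.toFun = cubeInd fun x => ∃ j, (f.term j).Sat x := by
  funext x
  by_cases h : ∃ j, (f.term j).Sat x
  · rw [toFun, if_pos h, cubeInd_of_pos h]
  · rw [toFun, if_neg h, cubeInd_of_neg h]

theorem concentratedOnCoeffs_of_mean_le {ε M : ℝ} (hM : 0 ≤ M) (h : cubeMean f.toFun ≤ ε) :
    ConcentratedOnCoeffs f.toFun ε M := by
  refine ⟨∅, by simpa using hM, concentratedOn_of_mean_sq_le _ ?_⟩
  simpa only [toFun_sq] using h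

theorem cubeMean_toFun_le_one : cubeMean f.toFun ≤ 1 := by
  rw [toFun_eq_cubeInd]
  exact cubeProb_le_one _

/-- The variance p(1 - p) of a Boolean function is at most 1/4. This covers 1/2 ≤ ε < 1, where
log(1/ε) may be close to 0 and only one coefficient is guaranteed. -/
theorem concentratedOnCoeffs_quarter : ConcentratedOnCoeffs f.toFun (1 / 4) 1 := by
  refine ⟨{∅}, by simp, ?_⟩
  unfold ConcentratedOn
  have h := Finset.sum_add_sum_compl {∅} fun S => fourierCoef f.toFun S ^ 2
  rw [sum_fourierCoef_sq, Finset.sum_singleton] at h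
  simp only [toFun_sq] at h
  have h0 : fourierCoef f.toFun ∅ = cubeMean f.toFun := by
    simp [fourierCoef, cubeMean, monomialChar]
  rw [h0] at h
  nlinarith [sq_nonneg (cubeMean f.toFun - 1 / 2)]

theorem cubeMean_toFun_le (hf : f.ExactWidth w) : cubeMean f.toFun ≤ f.size * 2⁻¹ ^ w := by
  have h := cubeProb_le_add_sum (p := fun x => ∃ j, (f.term j).Sat x) (q := fun _ => False)
    Finset.univ (fun j => (f.term j).Sat) fun x ⟨j, hj⟩ => Or.inr ⟨j, Finset.mem_univ j, hj⟩
  rw [cubeProb_eq_zero (p := fun _ => False) (fun _ h => h), zero_add,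
    Finset.sum_congr rfl fun j _ => by rw [f.cubeProb_sat j, hf j], Finset.sum_const,
    Finset.card_univ, Fintype.card_fin, nsmul_eq_mul] at h
  rwa [toFun_eq_cubeInd]

theorem exists_concentratedOnCoeffs_width : ∃ C : ℝ, 0 < C ∧
    ∀ (n w k : ℕ) (f : DNF n), 1 ≤ w → f.ExactWidth w → f.HasRead k →
      (k : ℝ) ≤ (w : ℝ) / (4 * Real.logb 2 (Real.exp 1 * (w : ℝ))) →
      ∀ ε : ℝ, 0 < ε →
        ConcentratedOnCoeffs f.toFun ε
          ((2 : ℝ) ^ (C * ((w : ℝ) * Real.logb 2 (1 / ε)))) := by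
  refine ⟨2 * (2 ^ 101 * 100 ^ 2), by norm_num, fun n w k f hw hf hk hkw ε hε => ?_⟩
  obtain ⟨hkw, hlog⟩ := exp_mul_pow_le_two_pow hw hkw
  -- For ε > 1 the permitted number of coefficients is below 1, so the empty family is used.
  rcases le_or_gt 1 ε with h1 | h1
  · exact concentratedOnCoeffs_of_mean_le (by positivity) (cubeMean_toFun_le_one.trans h1)
  set L := Real.logb 2 (1 / ε) with hL
  have h2L : (2 : ℝ) ^ L = 1 / ε := Real.rpow_logb (by norm_num) (by norm_num) (by positivity)
  rcases le_or_gt (1 / 2) ε with h2 | h2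
  · have hL0 : 0 ≤ L := Real.logb_nonneg (by norm_num) (by
      rw [le_div_iff₀ hε]
      linarith)
    refine ConcentratedOnCoeffs.mono concentratedOnCoeffs_quarter (by linarith) ?_
    exact Real.one_le_rpow (by norm_num) (by positivity)
  · have hL1 : 1 ≤ L := by
      rw [hL, Real.le_logb_iff_rpow_le (by norm_num) (by positivity), Real.rpow_one,
        le_div_iff₀ hε]
      linarith
    have hceil := Nat.le_ceil L
    have hceil2 := (Nat.ceil_lt_add_one (by linarith : 0 ≤ L)).le
    have hl : 1 ≤ ⌈L⌉₊ := Nat.one_le_ceil_iff.2 (by linarith)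
    refine ConcentratedOnCoeffs.mono (concentratedOnCoeffs_two_pow hf hw hk hkw hlog hl) ?_ ?_
    · rw [inv_pow, ← Real.rpow_natCast, inv_le_comm₀ (by positivity) hε, ← one_div, ← h2L]
      exact Real.rpow_le_rpow_of_exponent_le (by norm_num) hceil
    · rw [← Real.rpow_natCast]
      refine Real.rpow_le_rpow_of_exponent_le (by norm_num) ?_
      simp only [Nat.cast_mul, Nat.cast_pow, Nat.cast_ofNat]
      -- Since L ≥ 1, rounding up costs at most a factor 2, which is the leading 2 in the constant.
      have hl2 : (⌈L⌉₊ : ℝ) ≤ 2 * L := by linarith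
      calc (2 : ℝ) ^ 101 * 100 ^ 2 * (w * ⌈L⌉₊) ≤ 2 ^ 101 * 100 ^ 2 * (w * (2 * L)) := by gcongr
        _ = _ := by ring

end DNF

theorem mainTheorem5 :
    (∃ C : ℝ, 0 < C ∧
      ∀ (n w k : ℕ) (f : DNF n), 1 ≤ w → f.ExactWidth w → f.HasRead k →
        (k : ℝ) ≤ (w : ℝ) / (4 * Real.logb 2 (Real.exp 1 * (w : ℝ))) →
        ∀ ε : ℝ, 0 < ε →
          ConcentratedOnCoeffs f.toFun ε
            ((2 : ℝ) ^ (C * ((w : ℝ) * Real.logb 2 (1 / ε))))) ∧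
    (∀ ε : ℝ, 0 < ε → ∃ D : ℝ,
      ∀ (n w k : ℕ) (f : DNF n), 1 ≤ w → f.ExactWidth w → f.HasRead k →
        (k : ℝ) ≤ (w : ℝ) / (4 * Real.logb 2 (Real.exp 1 * (w : ℝ))) →
        2 ≤ f.size →
          ConcentratedOnCoeffs f.toFun ε ((f.size : ℝ) ^ D)) := by
  refine ⟨DNF.exists_concentratedOnCoeffs_width, fun ε hε => ?_⟩
  obtain ⟨C, hC, H⟩ := DNF.exists_concentratedOnCoeffs_width
  set L := Real.logb 2 (1 / ε) with hL
  -- If the formula is not negligible, 2^w ≤ size · 2^L ≤ size^(1 + L), using size ≥ 2; raising to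
  -- the power CL gives this exponent.
  refine ⟨C * L + C * L * L, fun n w k f hw hf hk hkw hs => ?_⟩
  have hs2 : (2 : ℝ) ≤ f.size := by exact_mod_cast hs
  rcases le_or_gt 1 ε with h1 | h1
  · exact DNF.concentratedOnCoeffs_of_mean_le (by positivity)
      (DNF.cubeMean_toFun_le_one.trans h1)
  rcases le_or_gt ((f.size : ℝ) * 2⁻¹ ^ w) ε with h2 | h2
  · exact DNF.concentratedOnCoeffs_of_mean_le (by positivity) ((DNF.cubeMean_toFun_le hf).trans h2)
  refine DNF.ConcentratedOnCoeffs.mono (H n w k f hw hf hk hkw ε hε) le_rfl ?_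
  have hL0 : 0 ≤ L := Real.logb_nonneg (by norm_num) (by
    rw [le_div_iff₀ hε]
    linarith)
  have h2L : (2 : ℝ) ^ L = 1 / ε := Real.rpow_logb (by norm_num) (by norm_num) (by positivity)
  have h3 : (2 : ℝ) ^ (w : ℝ) ≤ f.size * 2 ^ L := by
    rw [h2L, Real.rpow_natCast, mul_one_div, le_div_iff₀ hε]
    rw [inv_pow, ← div_eq_mul_inv, lt_div_iff₀ (by positivity)] at h2
    linarith
  have hCL : 0 ≤ C * L := by positivity
  have hs0 : (0 : ℝ) < f.size := by linarith
  calc (2 : ℝ) ^ (C * ((w : ℝ) * L)) = (2 ^ (w : ℝ)) ^ (C * L) := by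
        rw [← Real.rpow_mul (by norm_num)]
        congr 1
        ring
    _ ≤ (f.size * 2 ^ L) ^ (C * L) := Real.rpow_le_rpow (by positivity) h3 hCL
    _ ≤ (f.size * (f.size : ℝ) ^ L) ^ (C * L) := by gcongr
    _ = (f.size : ℝ) ^ (C * L + C * L * L) := by
        rw [Real.mul_rpow (by positivity) (by positivity), ← Real.rpow_mul hs0.le,
          Real.rpow_add hs0]
        congr 2
        ring
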